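/- Let $D\subsetneq\mathbb{C}$ be a domain, let $z\in D$, and suppose that there is a conformal map $\phi$ from $D$ onto the open unit disk $\mathbb{D}$ with $\phi(z)=0$ (equivalently, $D$ is simply connected); let $C(z,D)=|\phi'(z)|^{-1}$ be the conformal radius of $D$ viewed from $z$. Let $H^1_0(D)$ be the closure of $C_c^\infty(D)$ under the norm of the scalar product $\langle f,g\rangle_\nabla=\frac1{2\pi}\int_D\nabla f\cdot\nabla g$, and let $h=\sum_n a_n e_n$ be a Gaussian Free Field in $D$ with Dirichlet boundary conditions, where $(e_n)$ is an orthonormal basis of $H^1_0(D)$ and the $a_n$ are independent standard Gaussian variables. For $f=\sum_n\alpha_n e_n\in H^1_0(D)$ put $\langle h,f\rangle_\nabla=\sum_n a_n\alpha_n$ (almost sure limit of the partial sums). Let $G^z$ be the Green's function of $D$ with pole $z$, i.e. the function that is harmonic on $D\setminus\{z\}$, tends to $0$ at the boundary of $D$ (taken in the Riemann sphere) and satisfies $G^z(y)\sim\log\frac1{|z-y|}$ as $y\to z$; put $\tilde G^z(y)=G^z(y)-\log\frac1{|z-y|}$, extended continuously to $y=z$, and for $\varepsilon>0$ let $$G^z_\varepsilon(y)=\log\frac1{\max(\varepsilon,|z-y|)}+\tilde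 G^z(y).$$ If $0<\varepsilon\le \mathrm{dist}(z,\partial D)$, then $G^z_\varepsilon\in H^1_0(D)$, the circle average $h_\varepsilon(z):=\langle h,G^z_\varepsilon\rangle_\nabla$ is well defined (the series converges almost surely) and square integrable, and $$\mathrm{Var}\big(h_\varepsilon(z)\big)=\log\frac1\varepsilon+\log C(z,D).$$ -/

import Mathlib

open MeasureTheory ProbabilityTheory Filter Topology TopologicalSpace
open scoped Distributions

noncomputable section

namespace PlanarGFF

/-! ### Conformal maps and the conformal radius -/

/-- `φ` is a conformal map (a biholomorphism) from the set `U` onto the set `V`. -/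
def IsConformalMap (φ : ℂ → ℂ) (U V : Set ℂ) : Prop :=
  DifferentiableOn ℂ φ U ∧ Set.BijOn φ U V

/-- `C` is the conformal radius of `D` viewed from `z`: `C = |φ'(z)|⁻¹` for a conformal map `φ`
from `D` onto the open unit disk with `φ z = 0`. -/
def IsConformalRadius (D : Opens ℂ) (z : ℂ) (C : ℝ) : Prop :=
  ∃ φ : ℂ → ℂ, IsConformalMap φ (D : Set ℂ) (Metric.ball 0 1) ∧ φ z = 0 ∧ C = ‖deriv φ z‖⁻¹

/-! ### The Green's function -/

/-- The properties characterizing `G = G_D(x, ·)` on `D \ {x}` (values elsewhere are irrelevant).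
In `vanishes`, the filter `cocompact D` is the filter of points leaving every compact subset
of `D`, i.e. tending to the boundary of `D` in the Riemann sphere. -/
structure IsGreenFunction (D : Opens ℂ) (x : ℂ) (G : ℂ → ℝ) : Prop where
  harmonic : InnerProductSpace.HarmonicOnNhd G ((D : Set ℂ) \ {x})
  vanishes : Tendsto (fun y : D => G y) (cocompact D) (𝓝 0)
  singularity : Asymptotics.IsEquivalent (𝓝[≠] x) G (fun y => Real.log (1 / ‖x - y‖))

open Classical in
/-- The Green's function `G^x(y) = G_D(x, y)`. -/
def greenFunction (D : Opens ℂ) (x : ℂ) : ℂ → ℝ :=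
  if h : ∃ G, IsGreenFunction D x G then h.choose else 0

/-- The harmonic correction `G̃^x(y) = G^x(y) - log (1 / |x - y|)`, extended by continuity
at `y = x`. -/
def greenCorrection (D : Opens ℂ) (x : ℂ) : ℂ → ℝ :=
  Function.update (fun y => greenFunction D x y - Real.log (1 / ‖x - y‖)) x
    (limUnder (𝓝[≠] x) (fun y => greenFunction D x y - Real.log (1 / ‖x - y‖)))

/-- The regularized Green's function `G_ε^x(y) = log (1 / (ε ∨ |x - y|)) + G̃^x(y)`. -/
def regGreen (D : Opens ℂ) (ε : ℝ) (x : ℂ) (y : ℂ) : ℝ :=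
  Real.log (1 / max ε ‖x - y‖) + greenCorrection D x y

/-! ### The Sobolev space `H¹₀(D)` -/

/-- Lebesgue measure on `D` divided by `2π`, so that the inner product of its `L²` space is
`(1 / 2π) ∫_D u · v`. -/
def dirichletMeasure (D : Opens ℂ) : Measure ℂ :=
  ENNReal.ofReal (2 * Real.pi)⁻¹ • volume.restrict (D : Set ℂ)

theorem memLp_gradient (D : Opens ℂ) (f : 𝓓(D, ℝ)) :
    MemLp (fun x => gradient (f : ℂ → ℝ) x) 2 (dirichletMeasure D) := by
  have hf : ContDiff ℝ (⊤ : ℕ∞) (f : ℂ → ℝ) := f.contDiff'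
  have hc : Continuous (fun x => fderiv ℝ (f : ℂ → ℝ) x) :=
    hf.continuous_fderiv (by simp)
  have hs : HasCompactSupport (fun x => fderiv ℝ (f : ℂ → ℝ) x) :=
    f.hasCompactSupport'.fderiv (𝕜 := ℝ)
  have hg : Continuous (fun x => gradient (f : ℂ → ℝ) x) :=
    (InnerProductSpace.toDual ℝ ℂ).symm.continuous.comp hc
  have hgs : HasCompactSupport (fun x => gradient (f : ℂ → ℝ) x) :=
    hs.comp_left (g := (InnerProductSpace.toDual ℝ ℂ).symm) (map_zero _)
  have h : MemLp (fun x => gradient (f : ℂ → ℝ) x) 2 (volume : Measure ℂ) :=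
    hg.memLp_of_hasCompactSupport hgs
  exact (h.restrict _).smul_measure ENNReal.ofReal_ne_top

/-- The gradient of a test function, as a vector field in `L²`. (`ℂ` is used as `ℝ²`.) -/
def gradL2 (D : Opens ℂ) : 𝓓(D, ℝ) →ₗ[ℝ] Lp ℂ 2 (dirichletMeasure D) where
  toFun f := (memLp_gradient D f).toLp _
  map_add' f g := by
    rw [← MemLp.toLp_add]
    congr 1
    funext x
    have hf : DifferentiableAt ℝ (f : ℂ → ℝ) x :=
      (f.contDiff'.differentiable (by simp)) x
    have hg : DifferentiableAt ℝ (g : ℂ → ℝ) x :=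
      (g.contDiff'.differentiable (by simp)) x
    simp only [gradient, Pi.add_apply]
    rw [← map_add, ← fderiv_add hf hg]
    rfl
  map_smul' c f := by
    simp only [RingHom.id_apply]
    rw [← MemLp.toLp_const_smul]
    congr 1
    funext x
    have hf : DifferentiableAt ℝ (f : ℂ → ℝ) x :=
      (f.contDiff'.differentiable (by simp)) x
    simp only [gradient, Pi.smul_apply]
    rw [← map_smul, ← fderiv_const_smul hf]
    rfl

/-- The Hilbert space `H¹₀(D)`, the completion of the smooth compactly supported functions for
the norm `‖f‖² = (1 / 2π) ∫_D |∇f|²`, realized isometrically (through `f ↦ ∇f`) as the closure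
of the space of gradients in `L²`. Its inner product is `⟨f, g⟩ = (1 / 2π) ∫_D ∇f · ∇g`. -/
def H1 (D : Opens ℂ) : Submodule ℝ (Lp ℂ 2 (dirichletMeasure D)) :=
  (LinearMap.range (gradL2 D)).topologicalClosure

/-- The function `f` on `D` is the element `u` of `H¹₀(D)`: some sequence of test functions
converges to `u` in the norm of `H¹₀(D)` and to `f` in `L¹` on every compact subset of `D`. -/
def Represents {D : Opens ℂ} (u : H1 D) (f : ℂ → ℝ) : Prop :=
  ∃ φ : ℕ → 𝓓(D, ℝ),
    Tendsto (fun n => gradL2 D (φ n)) atTop (𝓝 (u : Lp ℂ 2 (dirichletMeasure D))) ∧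
    ∀ K : Set ℂ, IsCompact K → K ⊆ D →
      Tendsto (fun n => ∫⁻ x in K, ‖φ n x - f x‖ₑ) atTop (𝓝 0)

/-- The function `f` on `D` belongs to `H¹₀(D)`. -/
def MemH1 (D : Opens ℂ) (f : ℂ → ℝ) : Prop :=
  ∃ u : H1 D, Represents u f

open Classical in
/-- A function that belongs to `H¹₀(D)`, as an element of that space. -/
def toH1 (D : Opens ℂ) (f : ℂ → ℝ) : H1 D :=
  if h : MemH1 D f then h.choose else 0

/-! ### The Gaussian Free Field -/

/-- A Gaussian Free Field `h = ∑ aₙ eₙ` in `D` with Dirichlet boundary conditions: `(eₙ)` is an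
orthonormal basis of `H¹₀(D)` and the `aₙ` are independent standard Gaussian variables. -/
structure GFF (D : Opens ℂ) {Ω : Type*} [MeasurableSpace Ω] (P : Measure Ω) where
  basis : HilbertBasis ℕ ℝ (H1 D)
  coeff : ℕ → Ω → ℝ
  indep : iIndepFun coeff P
  law : ∀ n, HasLaw (coeff n) (gaussianReal 0 1) P

namespace GFF

variable {D : Opens ℂ} {Ω : Type*} [MeasurableSpace Ω] {P : Measure Ω}

/-- The partial sums of the series `⟨h, f⟩ = ∑ aₙ αₙ`, where `f = ∑ αₙ eₙ` in `H¹₀(D)`. -/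
def partialPairing (h : GFF D P) (f : H1 D) (N : ℕ) (ω : Ω) : ℝ :=
  ∑ n ∈ Finset.range N, h.coeff n ω * h.basis.repr f n

/-- The random variable `⟨h, f⟩ = ∑ aₙ αₙ` (limit of the partial sums). -/
def pairing (h : GFF D P) (f : H1 D) (ω : Ω) : ℝ :=
  limUnder atTop (fun N => h.partialPairing f N ω)

/-- The circle average `h_ε(z) = ⟨h, G_ε^z⟩`. -/
def circleAvg (h : GFF D P) (ε : ℝ) (z : ℂ) : Ω → ℝ :=
  h.pairing (toH1 D (regGreen D ε z))

end GFF

end PlanarGFF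

end

/-!
Write `φ` for the conformal map, `G` for the Green's function and `G̃` for its regular part. By the
maximum principle `G = -log |φ|`, so that `G̃ z = -log |φ' z| = log C`. Truncating `G` at the
circle `|y - z| = ε` turns the point charge of `G` into the uniform charge on that circle, of total
mass `2π`. Green's identity therefore gives
`(1 / 2π) ∫ ∇G_ε · ∇G_ε = mean of G_ε over the circle = G̃ z - log ε`,
by the mean value property of `G̃`. The Gaussian variable `∑ aₙ αₙ` has variance `∑ αₙ²`, which is
this Dirichlet norm.

Since `G_ε` is neither smooth nor compactly supported, the identity is applied to test functions
`f_b` obtained by rounding off the kink at the circle and cutting off near the boundary of `D`, both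
at height `b`. Up to errors of order `a + b`, the inner product of `f_a` and `f_b` is already
`G̃ z - log ε`, so the `f_b` form a Cauchy family whose limit represents `G_ε`.
-/

noncomputable section

namespace PlanarGFF

open Laplacian (laplacian)

/-! ### Conformal maps -/

namespace IsConformalMap

variable {φ : ℂ → ℂ} {U V : Set ℂ} {y : ℂ}

theorem analyticAt (h : IsConformalMap φ U V) (hU : IsOpen U) (hy : y ∈ U) :
    AnalyticAt ℂ φ y :=
  h.1.analyticAt (hU.mem_nhds hy)

theorem not_eventually_const (h : IsConformalMap φ U V) (hU : IsOpen U) (hy : y ∈ U) :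
    ¬ ∀ᶠ w in 𝓝 y, φ w = φ y := by
  intro hconst
  obtain ⟨w, ⟨hw, hwU⟩, hwy⟩ :=
    (((hconst.and (hU.eventually_mem hy)).filter_mono nhdsWithin_le_nhds).and
      (eventually_mem_nhdsWithin (a := y) (s := {y}ᶜ))).exists
  exact hwy (h.2.injOn hwU hy hw)

theorem nhds_le_map (h : IsConformalMap φ U V) (hU : IsOpen U) (hy : y ∈ U) :
    𝓝 (φ y) ≤ map φ (𝓝 y) :=
  (h.analyticAt hU hy).eventually_constant_or_nhds_le_map_nhds.resolve_left
    (h.not_eventually_const hU hy)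

theorem invFunOn_apply (h : IsConformalMap φ U V) (hy : y ∈ U) :
    Function.invFunOn φ U (φ y) = y :=
  h.2.injOn.leftInvOn_invFunOn hy

theorem continuousAt_invFunOn (h : IsConformalMap φ U V) (hU : IsOpen U) (hy : y ∈ U) :
    ContinuousAt (Function.invFunOn φ U) (φ y) := by
  rw [ContinuousAt, h.invFunOn_apply hy]
  refine (tendsto_map'_iff.2 (tendsto_id.congr' ?_)).mono_left (h.nhds_le_map hU hy)
  filter_upwards [hU.mem_nhds hy] with w hw
  exact (h.invFunOn_apply hw).symm

theorem isCompact_preimage (h : IsConformalMap φ U V) (hU : IsOpen U) {K : Set ℂ}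
    (hK : IsCompact K) (hKV : K ⊆ V) : IsCompact (U ∩ φ ⁻¹' K) := by
  have hcont : ContinuousOn (Function.invFunOn φ U) K := fun w hw => by
    obtain ⟨y, hy, rfl⟩ := h.2.surjOn (hKV hw)
    exact (h.continuousAt_invFunOn hU hy).continuousWithinAt
  convert hK.image_of_continuousOn hcont using 1
  ext y
  constructor
  · rintro ⟨hy, hyK⟩
    exact ⟨φ y, hyK, h.invFunOn_apply hy⟩
  · rintro ⟨w, hw, rfl⟩
    obtain ⟨y, hy, rfl⟩ := h.2.surjOn (hKV hw)
    rw [h.invFunOn_apply hy]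
    exact ⟨hy, hw⟩

theorem eventually_deriv_ne_zero (h : IsConformalMap φ U V) (hU : IsOpen U) (hy : y ∈ U) :
    ∀ᶠ w in 𝓝[≠] y, deriv φ w ≠ 0 := by
  refine (h.analyticAt hU hy).deriv.eventually_eq_zero_or_eventually_ne_zero.resolve_left
    fun hzero => h.not_eventually_const hU hy ?_
  obtain ⟨r, hr, hball⟩ := Metric.eventually_nhds_iff_ball.1 (hzero.and (hU.mem_nhds hy))
  filter_upwards [Metric.ball_mem_nhds y hr] with w hw
  exact Metric.isOpen_ball.is_const_of_deriv_eq_zero (convex_ball y r).isPreconnected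
    (h.1.mono fun x hx => (hball x hx).2) (fun x hx => (hball x hx).1) hw
    (Metric.mem_ball_self hr)

theorem differentiableAt_invFunOn (h : IsConformalMap φ U V) (hU : IsOpen U) (hy : y ∈ U)
    (hφ' : deriv φ y ≠ 0) : DifferentiableAt ℂ (Function.invFunOn φ U) (φ y) := by
  have hright : ∀ᶠ v in map φ (𝓝 y), φ (Function.invFunOn φ U v) = v := by
    rw [eventually_map]
    filter_upwards [hU.mem_nhds hy] with x hx
    rw [h.invFunOn_apply hx]
  have hderiv : HasDerivAt φ (deriv φ y) (Function.invFunOn φ U (φ y)) := by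
    rw [h.invFunOn_apply hy]
    exact (h.analyticAt hU hy).differentiableAt.hasDerivAt
  exact (hderiv.of_local_left_inverse (h.continuousAt_invFunOn hU hy) hφ'
    (h.nhds_le_map hU hy hright)).differentiableAt

theorem analyticAt_invFunOn (h : IsConformalMap φ U V) (hU : IsOpen U) (hy : y ∈ U) :
    AnalyticAt ℂ (Function.invFunOn φ U) (φ y) := by
  refine Complex.analyticAt_of_differentiable_on_punctured_nhds_of_continuousAt
    (eventually_nhdsWithin_iff.2 (h.nhds_le_map hU hy (eventually_map.2 ?_)))
    (h.continuousAt_invFunOn hU hy)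
  filter_upwards [hU.mem_nhds hy, eventually_nhdsWithin_iff.1 (h.eventually_deriv_ne_zero hU hy)]
    with w hw hw' hne
  exact h.differentiableAt_invFunOn hU hw (hw' fun hwy => hne (congrArg φ hwy))

theorem deriv_ne_zero (h : IsConformalMap φ U V) (hU : IsOpen U) (hy : y ∈ U) :
    deriv φ y ≠ 0 := by
  intro hzero
  have hcomp : HasDerivAt (Function.invFunOn φ U ∘ φ)
      (deriv (Function.invFunOn φ U) (φ y) * deriv φ y) y :=
    (h.analyticAt_invFunOn hU hy).differentiableAt.hasDerivAt.comp y
      (h.analyticAt hU hy).differentiableAt.hasDerivAt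
  have hid : HasDerivAt (Function.invFunOn φ U ∘ φ) 1 y := by
    refine (hasDerivAt_id y).congr_of_eventuallyEq ?_
    filter_upwards [hU.mem_nhds hy] with w hw
    exact h.invFunOn_apply hw
  rw [hzero, mul_zero] at hcomp
  exact zero_ne_one (hcomp.unique hid)

end IsConformalMap

/-! ### The maximum principle -/

theorem eventually_eq_of_harmonicAt_of_isLocalMax {u : ℂ → ℝ} {y : ℂ}
    (hu : InnerProductSpace.HarmonicAt u y) (hmax : IsLocalMax u y) : ∀ᶠ w in 𝓝 y, u w = u y := by
  obtain ⟨r, hr, hball⟩ := Metric.eventually_nhds_iff_ball.1 hu.eventually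
  obtain ⟨F, hF, hFu⟩ := InnerProductSpace.HarmonicOnNhd.exists_analyticOnNhd_ball_re_eq hball
  -- `exp u` is the modulus of the holomorphic function `exp F`, to which the maximum modulus
  -- principle applies.
  have hnorm : ∀ w ∈ Metric.ball y r, ‖Complex.exp (F w)‖ = Real.exp (u w) := fun w hw => by
    rw [Complex.norm_exp, ← hFu hw]
  have hy : y ∈ Metric.ball y r := Metric.mem_ball_self hr
  have hdiff : ∀ᶠ w in 𝓝 y, DifferentiableAt ℂ (fun w => Complex.exp (F w)) w := by
    filter_upwards [Metric.ball_mem_nhds y hr] with w hw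
    exact (hF w hw).differentiableAt.cexp
  have hloc : IsLocalMax (norm ∘ fun w => Complex.exp (F w)) y := by
    filter_upwards [Metric.ball_mem_nhds y hr, hmax] with w hw hwy
    simpa only [Function.comp_apply, hnorm w hw, hnorm y hy] using Real.exp_le_exp.2 hwy
  filter_upwards [Complex.eventually_eq_of_isLocalMax_norm hdiff hloc, Metric.ball_mem_nhds y hr]
    with w hw hwr
  exact Real.exp_injective (by rw [← hnorm w hwr, ← hnorm y hy, hw])

theorem nonpos_of_harmonicOnNhd {U : Set ℂ} (hU : IsOpen U) {u : ℂ → ℝ}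
    (hu : InnerProductSpace.HarmonicOnNhd u U)
    (h : ∀ δ > 0, ∃ K, IsCompact K ∧ K ⊆ U ∧ ∀ y ∈ U, δ ≤ u y → y ∈ K) :
    ∀ y ∈ U, u y ≤ 0 := by
  intro y₀ hy₀
  by_contra! hpos
  obtain ⟨K, hK, hKU, hmem⟩ := h _ hpos
  have hcont : ContinuousOn u K := hu.continuousOn.mono hKU
  obtain ⟨p, hpK, hp⟩ := hK.exists_isMaxOn ⟨y₀, hmem y₀ hy₀ le_rfl⟩ hcont
  have hp₀ : u y₀ ≤ u p := hp (hmem y₀ hy₀ le_rfl)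
  have hmax : ∀ y ∈ U, u y ≤ u p := fun y hy => by
    by_contra! hlt
    exact hlt.not_ge (hp (hmem y hy (hp₀.trans hlt.le)))
  have hcompact : IsCompact (K ∩ u ⁻¹' {u p}) :=
    hK.of_isClosed_subset (hcont.preimage_isClosed_of_isClosed hK.isClosed isClosed_singleton)
      Set.inter_subset_left
  have hopen : IsOpen (K ∩ u ⁻¹' {u p}) := by
    rw [isOpen_iff_mem_nhds]
    rintro y ⟨hyK, hy⟩
    have hloc : IsLocalMax u y := by
      filter_upwards [hU.mem_nhds (hKU hyK)] with w hw
      exact (hmax w hw).trans_eq hy.symm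
    filter_upwards [eventually_eq_of_harmonicAt_of_isLocalMax (hu y (hKU hyK)) hloc,
      hU.mem_nhds (hKU hyK)] with w hw hwU
    exact ⟨hmem w hwU ((hp₀.trans_eq hy.symm).trans_eq hw.symm), hw.trans hy⟩
  exact hcompact.ne_univ (IsClopen.eq_univ ⟨hcompact.isClosed, hopen⟩ ⟨p, hpK, rfl⟩)

theorem exists_isCompact_abs_lt {D : Opens ℂ} {F : ℂ → ℝ}
    (hF : Tendsto (fun y : D => F y) (cocompact D) (𝓝 0)) {δ : ℝ} (hδ : 0 < δ) :
    ∃ K, IsCompact K ∧ K ⊆ (D : Set ℂ) ∧ ∀ y ∈ D, y ∉ K → |F y| < δ := by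
  obtain ⟨K, hK, hKδ⟩ := mem_cocompact.1 (Metric.tendsto_nhds.1 hF δ hδ)
  refine ⟨Subtype.val '' K, hK.image continuous_subtype_val, Subtype.coe_image_subset _ _, ?_⟩
  intro y hy hyK
  have hmem : (⟨y, hy⟩ : D) ∈ Kᶜ := fun h => hyK ⟨_, h, rfl⟩
  simpa [Real.dist_eq] using hKδ hmem

theorem nonpos_of_harmonicOnNhd_diff_singleton {D : Opens ℂ} {z : ℂ} {u : ℂ → ℝ}
    (hu : InnerProductSpace.HarmonicOnNhd u ((D : Set ℂ) \ {z}))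
    (hvanishes : Tendsto (fun y : D => u y) (cocompact D) (𝓝 0))
    (hpole : ∀ᶠ y in 𝓝[≠] z, u y ≤ 0) : ∀ y ∈ (D : Set ℂ) \ {z}, u y ≤ 0 := by
  refine nonpos_of_harmonicOnNhd (D.isOpen.sdiff isClosed_singleton) hu fun δ hδ => ?_
  obtain ⟨K, hK, hKD, hKδ⟩ := exists_isCompact_abs_lt hvanishes hδ
  obtain ⟨r, hr, hball⟩ := Metric.eventually_nhds_iff_ball.1 (eventually_nhdsWithin_iff.1 hpole)
  refine ⟨K \ Metric.ball z r, hK.diff Metric.isOpen_ball, ?_, ?_⟩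
  · rintro y ⟨hyK, hyr⟩
    refine ⟨hKD hyK, ?_⟩
    rintro rfl
    exact hyr (Metric.mem_ball_self hr)
  · intro y hy hyδ
    refine ⟨?_, fun hyr => (hball y hyr hy.2).not_gt (hδ.trans_le hyδ)⟩
    by_contra hyK
    exact (abs_lt.1 (hKδ y hy.1 hyK)).2.not_ge hyδ

/-! ### Uniqueness of the Green's function -/

theorem tendsto_log_inv_norm_sub (z : ℂ) :
    Tendsto (fun y => Real.log (1 / ‖z - y‖)) (𝓝[≠] z) atTop := by
  have hnorm : Tendsto (fun y => ‖z - y‖) (𝓝[≠] z) (𝓝[>] 0) := by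
    refine tendsto_nhdsWithin_iff.2 ⟨?_, ?_⟩
    · have hcont : Continuous fun y : ℂ => ‖z - y‖ := by fun_prop
      simpa using (hcont.tendsto z).mono_left nhdsWithin_le_nhds
    · filter_upwards [eventually_mem_nhdsWithin] with y hy
      exact norm_pos_iff.2 (sub_ne_zero.2 (Ne.symm hy))
  refine (tendsto_neg_atBot_atTop.comp (Real.tendsto_log_nhdsGT_zero.comp hnorm)).congr fun y => ?_
  simp [Real.log_inv]

namespace IsGreenFunction

variable {D : Opens ℂ} {z : ℂ} {G G' : ℂ → ℝ}

theorem nonneg (hG : IsGreenFunction D z G) : ∀ y ∈ (D : Set ℂ) \ {z}, 0 ≤ G y := by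
  have hpole : ∀ᶠ y in 𝓝[≠] z, (-G) y ≤ 0 := by
    filter_upwards [(hG.singularity.symm.tendsto_atTop
      (tendsto_log_inv_norm_sub z)).eventually_ge_atTop 0] with y hy
    exact neg_nonpos.2 hy
  have hneg := nonpos_of_harmonicOnNhd_diff_singleton hG.harmonic.neg
    (by simpa using hG.vanishes.neg) hpole
  exact fun y hy => neg_nonpos.1 (hneg y hy)

theorem eventually_sub_le (hG : IsGreenFunction D z G) (hG' : IsGreenFunction D z G') {δ : ℝ}
    (hδ : 0 < δ) : ∀ᶠ y in 𝓝[≠] z, G y - G' y ≤ δ * G' y := by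
  have hsub : (fun y => G y - G' y) =o[𝓝[≠] z] G' :=
    (hG.singularity.trans hG'.singularity.symm).isLittleO
  filter_upwards [hsub.def hδ, (hG'.singularity.symm.tendsto_atTop
    (tendsto_log_inv_norm_sub z)).eventually_ge_atTop 0] with y hy hpos
  rw [Real.norm_eq_abs, Real.norm_eq_abs, abs_of_nonneg hpos] at hy
  exact (le_abs_self _).trans hy

theorem le (hG : IsGreenFunction D z G) (hG' : IsGreenFunction D z G') :
    ∀ y ∈ (D : Set ℂ) \ {z}, G y ≤ G' y := by
  -- `G - G' - δ G'` vanishes at the boundary and is negative near the pole, for every `δ > 0`.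
  have hδ : ∀ δ : ℝ, 0 < δ → ∀ y ∈ (D : Set ℂ) \ {z}, (G - G' - δ • G') y ≤ 0 := fun δ hδ => by
    have hvanishes : Tendsto (fun y : D => (G - G' - δ • G') y) (cocompact D) (𝓝 0) := by
      simpa using (hG.vanishes.sub hG'.vanishes).sub (hG'.vanishes.const_mul δ)
    refine nonpos_of_harmonicOnNhd_diff_singleton
      ((hG.harmonic.sub hG'.harmonic).sub hG'.harmonic.const_smul) hvanishes ?_
    filter_upwards [hG.eventually_sub_le hG' hδ] with y hy using sub_nonpos.2 hy
  intro y hy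
  have hlim : Tendsto (fun δ : ℝ => (G - G' - δ • G') y) (𝓝[>] 0) (𝓝 (G y - G' y)) := by
    have hcont : Continuous fun δ : ℝ => G y - G' y - δ * G' y := by fun_prop
    simpa using (hcont.tendsto 0).mono_left nhdsWithin_le_nhds
  exact sub_nonpos.1 (le_of_tendsto hlim (eventually_nhdsWithin_of_forall fun δ h => hδ δ h y hy))

theorem eqOn (hG : IsGreenFunction D z G) (hG' : IsGreenFunction D z G') :
    Set.EqOn G G' ((D : Set ℂ) \ {z}) :=
  fun y hy => le_antisymm (hG.le hG' y hy) (hG'.le hG y hy)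

theorem greenFunction_eqOn (hG : IsGreenFunction D z G) :
    Set.EqOn (greenFunction D z) G ((D : Set ℂ) \ {z}) := by
  have hex : ∃ G, IsGreenFunction D z G := ⟨G, hG⟩
  rw [greenFunction, dif_pos hex]
  exact hex.choose_spec.eqOn hG

end IsGreenFunction

/-! ### The regular part of the Green's function -/

/-- `H` is the regular part `G̃^z` of a Green's function of `D` with pole `z`. The constraint that
`H` be harmonic at `z` too replaces the extension by continuity of `greenCorrection`. -/
structure IsGreenCorrection (D : Opens ℂ) (z : ℂ) (H : ℂ → ℝ) : Prop where
  mem : z ∈ D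
  harmonic : InnerProductSpace.HarmonicOnNhd H D
  vanishes : Tendsto (fun y : D => H y - Real.log ‖y - z‖) (cocompact D) (𝓝 0)

namespace IsGreenCorrection

variable {D : Opens ℂ} {z : ℂ} {H : ℂ → ℝ}

theorem isGreenFunction (hH : IsGreenCorrection D z H) :
    IsGreenFunction D z fun y => H y - Real.log ‖y - z‖ where
  harmonic y hy := by
    refine (hH.harmonic y hy.1).sub ?_
    exact AnalyticAt.harmonicAt_log_norm (f := fun y => y - z) (by fun_prop) (sub_ne_zero.2 hy.2)
  vanishes := hH.vanishes
  singularity := by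
    have hbounded : H =O[𝓝[≠] z] fun _ => (1 : ℝ) :=
      ((hH.harmonic z hH.mem).1.continuousAt.tendsto.mono_left nhdsWithin_le_nhds).isBigO_one ℝ
    have hpole : (fun _ => (1 : ℝ)) =o[𝓝[≠] z] fun y => Real.log (1 / ‖z - y‖) :=
      Asymptotics.isLittleO_const_left.2
        (Or.inr (tendsto_abs_atTop_atTop.comp (tendsto_log_inv_norm_sub z)))
    refine (hbounded.trans_isLittleO hpole).congr_left fun y => ?_
    rw [Pi.sub_apply, norm_sub_rev z y, one_div, Real.log_inv]
    ring

theorem greenCorrection_eqOn (hH : IsGreenCorrection D z H) :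
    Set.EqOn (greenCorrection D z) H D := by
  have hoff : ∀ y ∈ (D : Set ℂ) \ {z}, greenFunction D z y - Real.log (1 / ‖z - y‖) = H y := by
    intro y hy
    rw [hH.isGreenFunction.greenFunction_eqOn hy, norm_sub_rev z y, one_div, Real.log_inv]
    ring
  intro y hy
  rcases eq_or_ne y z with rfl | hyz
  · rw [greenCorrection, Function.update_self]
    refine Tendsto.limUnder_eq (((hH.harmonic y hy).1.continuousAt.tendsto.mono_left
      nhdsWithin_le_nhds).congr' ?_)
    filter_upwards [eventually_mem_nhdsWithin, nhdsWithin_le_nhds (D.isOpen.mem_nhds hy)]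
      with w hwy hw
    exact (hoff w ⟨hw, hwy⟩).symm
  · rw [greenCorrection, Function.update_of_ne hyz]
    exact hoff y ⟨hy, hyz⟩

theorem log_norm_sub_le (hH : IsGreenCorrection D z H) {y : ℂ} (hy : y ∈ D) (hyz : y ≠ z) :
    Real.log ‖y - z‖ ≤ H y :=
  sub_nonneg.1 (hH.isGreenFunction.nonneg y ⟨hy, hyz⟩)

theorem exists_isCompact_lt (hH : IsGreenCorrection D z H) {δ : ℝ} (hδ : 0 < δ) :
    ∃ K, IsCompact K ∧ K ⊆ (D : Set ℂ) ∧ ∀ y ∈ D, y ∉ K → H y - Real.log ‖y - z‖ < δ := by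
  obtain ⟨K, hK, hKD, hKδ⟩ :=
    exists_isCompact_abs_lt (F := fun y => H y - Real.log ‖y - z‖) hH.vanishes hδ
  exact ⟨K, hK, hKD, fun y hy hyK => (abs_lt.1 (hKδ y hy hyK)).2⟩

end IsGreenCorrection

namespace IsConformalMap

variable {D : Opens ℂ} {U V : Set ℂ} {φ : ℂ → ℂ} {z y : ℂ}

theorem dslope_ne_zero (hφ : IsConformalMap φ U V) (hU : IsOpen U) (hz : z ∈ U) (hy : y ∈ U) :
    dslope φ z y ≠ 0 := by
  rcases eq_or_ne y z with rfl | hyz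
  · rw [dslope_same]
    exact hφ.deriv_ne_zero hU hy
  · rw [dslope_of_ne _ hyz, slope_def_field]
    exact div_ne_zero (sub_ne_zero.2 fun h => hyz (hφ.2.injOn hy hz h)) (sub_ne_zero.2 hyz)

theorem harmonicOnNhd_log_norm_dslope (hφ : IsConformalMap φ U V) (hU : IsOpen U) (hz : z ∈ U) :
    InnerProductSpace.HarmonicOnNhd (fun y => Real.log ‖dslope φ z y‖) U := by
  intro y hy
  have hanalytic : AnalyticAt ℂ (dslope φ z) y :=
    ((Complex.differentiableOn_dslope (hU.mem_nhds hz)).2 hφ.1).analyticAt (hU.mem_nhds hy)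
  exact hanalytic.harmonicAt_log_norm (hφ.dslope_ne_zero hU hz hy)

theorem log_norm_sub_eq_add_log_norm_dslope (hφ : IsConformalMap φ U V) (hU : IsOpen U)
    (hz : z ∈ U) (hy : y ∈ U) (hyz : y ≠ z) :
    Real.log ‖φ y - φ z‖ = Real.log ‖y - z‖ + Real.log ‖dslope φ z y‖ := by
  rw [← sub_smul_dslope φ z y, norm_smul, Real.log_mul (norm_ne_zero_iff.2 (sub_ne_zero.2 hyz))
    (norm_ne_zero_iff.2 (hφ.dslope_ne_zero hU hz hy))]

theorem tendsto_norm_cocompact (hφ : IsConformalMap φ D (Metric.ball 0 1)) :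
    Tendsto (fun y : D => ‖φ y‖) (cocompact D) (𝓝 1) := by
  refine tendsto_order.2 ⟨fun r hr => ?_, fun r hr => Eventually.of_forall fun y => ?_⟩
  · have hcompact : IsCompact ((fun y : D => φ y) ⁻¹' Metric.closedBall 0 r) := by
      rw [Subtype.isCompact_iff]
      convert hφ.isCompact_preimage D.isOpen (isCompact_closedBall (0 : ℂ) r)
        (Metric.closedBall_subset_ball hr) using 1
      ext y
      simp [and_comm]
    filter_upwards [hcompact.compl_mem_cocompact] with y hy
    simpa using hy
  · exact (mem_ball_zero_iff.1 (hφ.2.mapsTo y.2)).trans hr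

theorem isGreenCorrection (hφ : IsConformalMap φ D (Metric.ball 0 1)) (hz : z ∈ D)
    (hφz : φ z = 0) : IsGreenCorrection D z fun y => -Real.log ‖dslope φ z y‖ where
  mem := hz
  harmonic _ hy := (hφ.harmonicOnNhd_log_norm_dslope D.isOpen hz _ hy).neg
  vanishes := by
    have hlog : Tendsto (fun y : D => -Real.log ‖φ y‖) (cocompact D) (𝓝 0) := by
      simpa using ((Real.continuousAt_log one_ne_zero).tendsto.comp hφ.tendsto_norm_cocompact).neg
    refine hlog.congr' ?_
    filter_upwards [(isCompact_singleton (x := (⟨z, hz⟩ : D))).compl_mem_cocompact] with y hy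
    have hyz : (y : ℂ) ≠ z := fun h => hy (Subtype.ext h)
    have hfactor := hφ.log_norm_sub_eq_add_log_norm_dslope D.isOpen hz y.2 hyz
    rw [hφz, sub_zero] at hfactor
    rw [hfactor]
    ring

end IsConformalMap

/-! ### Green's identity and polar coordinates -/

section SecondDerivative

variable {E : Type*} [NormedAddCommGroup E] [NormedSpace ℝ E]

theorem continuous_fderiv_fderiv_apply {f : E → ℝ} (hf : ContDiff ℝ 2 f) (e : E) :
    Continuous fun y => fderiv ℝ (fun w => fderiv ℝ f w e) y e :=
  (((hf.fderiv_right (m := 1) (by norm_num)).clm_apply contDiff_const).continuous_fderiv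
    (by simp)).clm_apply continuous_const

theorem fderiv_fderiv_comp_apply {S : ℝ → ℝ} (hS : ContDiff ℝ 2 S) {f : E → ℝ} {y : E}
    (hf : ContDiffAt ℝ 2 f y) (e : E) :
    fderiv ℝ (fun w => fderiv ℝ (fun w => S (f w)) w e) y e =
      deriv S (f y) * fderiv ℝ (fun w => fderiv ℝ f w e) y e +
        deriv (deriv S) (f y) * (fderiv ℝ f y e * fderiv ℝ f y e) := by
  have hS' : ContDiff ℝ 1 (deriv S) :=
    (contDiff_succ_iff_deriv.1 (show ContDiff ℝ (1 + 1) S from hS)).2.2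
  have hfirst : (fun w => fderiv ℝ (fun w => S (f w)) w e) =ᶠ[𝓝 y]
      fun w => deriv S (f w) * fderiv ℝ f w e := by
    filter_upwards [hf.eventually (by simp)] with w hw
    have hcomp := (hS.differentiable (by simp) (f w)).hasDerivAt.comp_hasFDerivAt w
      (hw.differentiableAt (by simp)).hasFDerivAt
    rw [show (fun w => S (f w)) = S ∘ f from rfl, hcomp.fderiv]
    simp
  have houter : HasFDerivAt (fun w => deriv S (f w)) (deriv (deriv S) (f y) • fderiv ℝ f y) y :=
    (hS'.differentiable (by simp) (f y)).hasDerivAt.comp_hasFDerivAt y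
      (hf.differentiableAt (by simp)).hasFDerivAt
  have hinner : DifferentiableAt ℝ (fun w => fderiv ℝ f w e) y :=
    ((hf.fderiv_right (m := 1) (by norm_num)).differentiableAt (by simp)).clm_apply
      (differentiableAt_const _)
  rw [hfirst.fderiv_eq]
  refine (congrArg (· e) (houter.mul hinner.hasFDerivAt).fderiv).trans ?_
  simp only [add_apply, smul_apply, smul_eq_mul]
  ring

end SecondDerivative

section Laplacian

variable {E : Type*} [NormedAddCommGroup E] [InnerProductSpace ℝ E]

theorem inner_gradient_left [CompleteSpace E] (u : E → ℝ) (y v : E) :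
    inner ℝ (gradient u y) v = fderiv ℝ u y v := by
  rw [gradient, InnerProductSpace.toDual_symm_apply]

theorem inner_gradient_gradient_eq_sum [CompleteSpace E] {ι : Type*} [Fintype ι]
    (b : OrthonormalBasis ι ℝ E) (u v : E → ℝ) (y : E) :
    inner ℝ (gradient u y) (gradient v y) = ∑ i, fderiv ℝ u y (b i) * fderiv ℝ v y (b i) := by
  rw [← b.sum_inner_mul_inner]
  exact Finset.sum_congr rfl fun i _ => by
    rw [inner_gradient_left, real_inner_comm, inner_gradient_left]

variable [FiniteDimensional ℝ E] {ι : Type*} [Fintype ι]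

theorem laplacian_eq_sum_fderiv (b : OrthonormalBasis ι ℝ E) {f : E → ℝ} {y : E}
    (hf : ContDiffAt ℝ 2 f y) :
    laplacian f y = ∑ i, fderiv ℝ (fun w => fderiv ℝ f w (b i)) y (b i) := by
  have hdiff : DifferentiableAt ℝ (fderiv ℝ f) y :=
    (hf.fderiv_right (m := 1) (by norm_num)).differentiableAt (by simp)
  rw [InnerProductSpace.laplacian_eq_iteratedFDeriv_orthonormalBasis f b]
  refine Finset.sum_congr rfl fun i _ => ?_
  rw [iteratedFDeriv_two_apply, fderiv_clm_apply hdiff (differentiableAt_const _)]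
  simp

theorem continuous_laplacian {f : E → ℝ} (hf : ContDiff ℝ 2 f) : Continuous (laplacian f) := by
  rw [show laplacian f = _ from
    funext fun y => laplacian_eq_sum_fderiv (stdOrthonormalBasis ℝ E) hf.contDiffAt]
  exact continuous_finsetSum _ fun i _ => continuous_fderiv_fderiv_apply hf _

theorem tsupport_laplacian_subset (f : E → ℝ) : tsupport (laplacian f) ⊆ tsupport f := by
  refine closure_minimal (fun y hy => ?_) (isClosed_tsupport f)
  by_contra hyf
  have hzero : f =ᶠ[𝓝 y] fun _ => 0 := notMem_tsupport_iff_eventuallyEq.1 hyf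
  exact hy (by simp [(InnerProductSpace.laplacian_congr_nhds hzero).eq_of_nhds])

theorem laplacian_comp {S : ℝ → ℝ} (hS : ContDiff ℝ 2 S) {f : E → ℝ} {y : E}
    (hf : ContDiffAt ℝ 2 f y) :
    laplacian (fun w => S (f w)) y =
      deriv S (f y) * laplacian f y + deriv (deriv S) (f y) * ‖gradient f y‖ ^ 2 := by
  have hSf : ContDiffAt ℝ 2 (fun w => S (f w)) y := hS.contDiffAt.comp y hf
  rw [laplacian_eq_sum_fderiv (stdOrthonormalBasis ℝ E) hSf,
    laplacian_eq_sum_fderiv (stdOrthonormalBasis ℝ E) hf, ← real_inner_self_eq_norm_sq,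
    inner_gradient_gradient_eq_sum (stdOrthonormalBasis ℝ E), Finset.mul_sum, Finset.mul_sum,
    ← Finset.sum_add_distrib]
  exact Finset.sum_congr rfl fun i _ => fderiv_fderiv_comp_apply hS hf _

theorem laplacian_comp_add_const {S : ℝ → ℝ} (hS : ContDiff ℝ 2 S) {f : E → ℝ} {y : E}
    (hf : ContDiffAt ℝ 2 f y) (c : ℝ) :
    laplacian (fun w => S (f w + c)) y = deriv S (f y + c) * laplacian f y +
      deriv (deriv S) (f y + c) * ‖gradient f y‖ ^ 2 := by
  have hderiv : (deriv fun s => S (s + c)) = fun s => deriv S (s + c) :=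
    funext fun s => deriv_comp_add_const S c s
  rw [laplacian_comp (S := fun s => S (s + c)) (hS.comp (contDiff_id.add contDiff_const)) hf,
    hderiv, deriv_comp_add_const]

variable [MeasurableSpace E] [BorelSpace E] {μ : Measure E} [μ.IsAddHaarMeasure]

theorem integral_inner_gradient {u v : E → ℝ} (hu : ContDiff ℝ 1 u) (hv : ContDiff ℝ 2 v)
    (hv_supp : HasCompactSupport v) :
    ∫ y, inner ℝ (gradient u y) (gradient v y) ∂μ = -∫ y, u y * laplacian v y ∂μ := by
  have hv' : ∀ e, ContDiff ℝ 1 fun y => fderiv ℝ v y e := fun e =>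
    (hv.fderiv_right (m := 1) (by norm_num)).clm_apply contDiff_const
  have hv'_supp : ∀ e, HasCompactSupport fun y => fderiv ℝ v y e := fun e =>
    hv_supp.fderiv_apply (𝕜 := ℝ) e
  have hint₁ : ∀ e, Integrable (fun y => fderiv ℝ u y e * fderiv ℝ v y e) μ := fun e =>
    (((hu.continuous_fderiv (by simp)).clm_apply continuous_const).mul
      (hv' e).continuous).integrable_of_hasCompactSupport (hv'_supp e).mul_left
  have hint₂ : ∀ e, Integrable (fun y => u y * fderiv ℝ (fun w => fderiv ℝ v w e) y e) μ :=
    fun e => (hu.continuous.mul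
      (continuous_fderiv_fderiv_apply hv e)).integrable_of_hasCompactSupport
        ((hv'_supp e).fderiv_apply (𝕜 := ℝ) e).mul_left
  have hparts : ∀ e, ∫ y, u y * fderiv ℝ (fun w => fderiv ℝ v w e) y e ∂μ =
      -∫ y, fderiv ℝ u y e * fderiv ℝ v y e ∂μ := fun e =>
    integral_mul_fderiv_eq_neg_fderiv_mul_of_integrable (hint₁ e) (hint₂ e)
      ((hu.continuous.mul (hv' e).continuous).integrable_of_hasCompactSupport (hv'_supp e).mul_left)
      (fun y _ => hu.differentiable (by simp) y) (fun y _ => (hv' e).differentiable (by simp) y)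
  simp only [inner_gradient_gradient_eq_sum (stdOrthonormalBasis ℝ E), Finset.mul_sum,
    fun y => laplacian_eq_sum_fderiv (stdOrthonormalBasis ℝ E) (hv.contDiffAt (x := y))]
  rw [integral_finsetSum _ fun i _ => hint₁ _, integral_finsetSum _ fun i _ => hint₂ _,
    ← Finset.sum_neg_distrib]
  exact Finset.sum_congr rfl fun i _ => by rw [hparts, neg_neg]

theorem integral_laplacian_eq_zero {v : E → ℝ} (hv : ContDiff ℝ 2 v)
    (hv_supp : HasCompactSupport v) : ∫ y, laplacian v y ∂μ = 0 := by
  have hparts := integral_inner_gradient (μ := μ) (u := fun _ => (1 : ℝ)) contDiff_const hv hv_supp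
  have hgrad : ∀ y, gradient (fun _ : E => (1 : ℝ)) y = 0 := fun y => by simp [gradient]
  simpa [hgrad] using hparts

end Laplacian

theorem norm_gradient_log_norm_sub {E : Type*} [NormedAddCommGroup E] [InnerProductSpace ℝ E]
    [CompleteSpace E] {y z : E} (hyz : y ≠ z) :
    ‖gradient (fun w => Real.log ‖w - z‖) y‖ = ‖y - z‖⁻¹ := by
  have hpos : 0 < ‖y - z‖ := norm_pos_iff.2 (sub_ne_zero.2 hyz)
  have hsq : HasFDerivAt (fun w : E => ‖w - z‖ ^ 2) (2 • innerSL ℝ (y - z)) y := by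
    have hcomp := (hasStrictFDerivAt_norm_sq (y - z)).hasFDerivAt.comp y
      ((hasFDerivAt_id (𝕜 := ℝ) y).sub_const z)
    simpa [Function.comp_def] using hcomp
  have hhalf : (fun w => Real.log ‖w - z‖) = fun w => 1 / 2 * Real.log (‖w - z‖ ^ 2) := by
    funext w
    rw [Real.log_pow]
    push_cast
    ring
  have hgrad : HasGradientAt (fun w => Real.log ‖w - z‖) ((‖y - z‖ ^ 2)⁻¹ • (y - z)) y := by
    rw [hhalf, hasGradientAt_iff_hasFDerivAt]
    refine ((hsq.log (by positivity)).const_mul (1 / 2 : ℝ)).congr_fderiv ?_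
    ext v
    rw [InnerProductSpace.toDual_apply_apply, real_inner_smul_left]
    simp only [smul_apply, innerSL_apply_apply, smul_eq_mul, nsmul_eq_mul]
    push_cast
    ring
  rw [hgrad.gradient, norm_smul, norm_inv, norm_pow, norm_norm]
  field_simp

theorem laplacian_log_norm_sub {y z : ℂ} (hyz : y ≠ z) :
    laplacian (fun w => Real.log ‖w - z‖) y = 0 := by
  have hanalytic : AnalyticAt ℂ (fun w => w - z) y := by fun_prop
  exact (hanalytic.harmonicAt_log_norm (sub_ne_zero.2 hyz)).2.eq_of_nhds

section Polar

variable {E : Type*} [NormedAddCommGroup E] [NormedSpace ℝ E]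

theorem integrableOn_comp_polarCoord_symm {f : ℂ → E} (hf : Integrable f) :
    IntegrableOn (fun p : ℝ × ℝ => p.1 • f (Complex.polarCoord.symm p)) polarCoord.target := by
  have hprod : Integrable (f ∘ Complex.measurableEquivRealProd.symm) :=
    Complex.volume_preserving_equiv_real_prod.symm.integrable_comp_of_integrable hf
  have himage := (integrableOn_image_iff_integrableOn_abs_det_fderiv_smul volume
    polarCoord.open_target.measurableSet
    (fun p _ => (hasFDerivAt_polarCoord_symm p).hasFDerivWithinAt) polarCoord.symm.injOn _).1
    hprod.integrableOn
  refine himage.congr_fun (fun p hp => ?_) polarCoord.open_target.measurableSet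
  beta_reduce
  rw [det_fderivPolarCoordSymm, abs_of_pos hp.1]
  rfl

theorem integral_eq_integral_smul_circleAverage {f : ℂ → E} (hf : Integrable f) (z : ℂ) :
    ∫ y, f y = (2 * Real.pi) • ∫ r in Set.Ioi (0 : ℝ), r • Real.circleAverage f z r := by
  have hpi := Real.pi_pos
  have hpolar : ∀ p : ℝ × ℝ, z + Complex.polarCoord.symm p = circleMap z p.1 p.2 := fun p => by
    simp only [Complex.polarCoord_symm_apply, circleMap, Complex.exp_mul_I, Complex.ofReal_cos,
      Complex.ofReal_sin]
  have hint := integrableOn_comp_polarCoord_symm (hf.comp_add_left z)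
  have hangle : ∀ r : ℝ, ∫ θ in Set.Ioo (-Real.pi) Real.pi, r • f (circleMap z r θ) =
      (2 * Real.pi) • r • Real.circleAverage f z r := fun r => by
    have hper : Function.Periodic (fun θ => f (circleMap z r θ)) (2 * Real.pi) := fun θ => by
      simp only [periodic_circleMap z r θ]
    have hshift := hper.intervalIntegral_add_eq (-Real.pi) 0
    rw [zero_add, show -Real.pi + 2 * Real.pi = Real.pi by ring,
      intervalIntegral.integral_of_le (by linarith), integral_Ioc_eq_integral_Ioo] at hshift
    rw [integral_smul, hshift, Real.circleAverage_def, smul_comm, smul_inv_smul₀ (by positivity)]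
  rw [← integral_add_left_eq_self f z, ← Complex.integral_comp_polarCoord_symm]
  simp only [polarCoord_target, hpolar] at hint ⊢
  rw [Measure.volume_eq_prod, setIntegral_prod _ hint, ← integral_smul]
  simp only [hangle]

theorem integral_norm_sub_smul {w : ℝ → ℝ} {f : ℂ → E} {z : ℂ}
    (hint : Integrable fun y => w ‖y - z‖ • f y) :
    ∫ y, w ‖y - z‖ • f y =
      (2 * Real.pi) • ∫ r in Set.Ioi (0 : ℝ), (r * w r) • Real.circleAverage f z r := by
  rw [integral_eq_integral_smul_circleAverage hint z]
  congr 1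
  refine setIntegral_congr_fun measurableSet_Ioi fun r hr => ?_
  have hsphere : Real.circleAverage (fun y => w ‖y - z‖ • f y) z r =
      Real.circleAverage (fun y => w r • f y) z r :=
    Real.circleAverage_congr_sphere fun y hy => by
      simp only [mem_sphere_iff_norm.1 hy, abs_of_pos (Set.mem_Ioi.1 hr)]
  simp only [hsphere, Real.circleAverage_fun_smul, mul_smul]

end Polar

/-! ### A smooth convex approximation of the positive part -/

/-- A smooth convex function, vanishing for `s ≤ 0` and of slope one for `s ≥ a`. -/
def softRamp (a s : ℝ) : ℝ := ∫ t in (0 : ℝ)..s, Real.smoothTransition (t / a)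

namespace softRamp

variable {a : ℝ}

theorem continuous_slope (a : ℝ) : Continuous fun t => Real.smoothTransition (t / a) :=
  Real.smoothTransition.continuous.comp (by fun_prop)

theorem hasDerivAt (a s : ℝ) : HasDerivAt (softRamp a) (Real.smoothTransition (s / a)) s :=
  ((continuous_slope a).integral_hasStrictDerivAt 0 s).hasDerivAt

theorem deriv_eq (a : ℝ) : deriv (softRamp a) = fun s => Real.smoothTransition (s / a) :=
  funext fun s => (hasDerivAt a s).deriv

theorem contDiff (a : ℝ) : ContDiff ℝ (⊤ : ℕ∞) (softRamp a) := by
  rw [contDiff_infty_iff_deriv, deriv_eq]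
  exact ⟨fun s => (hasDerivAt a s).differentiableAt,
    Real.smoothTransition.contDiff.comp (by fun_prop)⟩

theorem contDiff_two (a : ℝ) : ContDiff ℝ 2 (softRamp a) := contDiff_infty.1 (contDiff a) 2

theorem sub_eq_integral (a s t : ℝ) :
    softRamp a t - softRamp a s = ∫ x in s..t, Real.smoothTransition (x / a) :=
  intervalIntegral.integral_interval_sub_left ((continuous_slope a).intervalIntegrable _ _)
    ((continuous_slope a).intervalIntegrable _ _)

theorem monotone (a : ℝ) : Monotone (softRamp a) := fun s t hst => by
  rw [← sub_nonneg, sub_eq_integral]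
  exact intervalIntegral.integral_nonneg hst fun x _ => Real.smoothTransition.nonneg _

theorem sub_le_sub {s t : ℝ} (hst : s ≤ t) : softRamp a t - softRamp a s ≤ t - s := by
  rw [sub_eq_integral]
  calc ∫ x in s..t, Real.smoothTransition (x / a) ≤ ∫ _ in s..t, (1 : ℝ) :=
        intervalIntegral.integral_mono_on hst ((continuous_slope a).intervalIntegrable _ _)
          (by simp) fun x _ => Real.smoothTransition.le_one _
    _ = t - s := by simp

theorem eq_zero (ha : 0 < a) {s : ℝ} (hs : s ≤ 0) : softRamp a s = 0 := by
  rw [softRamp, intervalIntegral.integral_congr (g := fun _ => 0)]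
  · simp
  · intro t ht
    rw [Set.uIcc_of_ge hs] at ht
    exact Real.smoothTransition.zero_of_nonpos (div_nonpos_of_nonpos_of_nonneg ht.2 ha.le)

theorem nonneg (ha : 0 < a) (s : ℝ) : 0 ≤ softRamp a s := by
  rcases le_total s 0 with hs | hs
  · rw [eq_zero ha hs]
  · rw [← eq_zero ha le_rfl]
    exact monotone a hs

theorem le_self (ha : 0 < a) {s : ℝ} (hs : 0 ≤ s) : softRamp a s ≤ s := by
  simpa [eq_zero ha le_rfl] using sub_le_sub (a := a) hs

theorem sub_eq_of_le (ha : 0 < a) {s t : ℝ} (hs : a ≤ s) (ht : a ≤ t) :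
    softRamp a t - softRamp a s = t - s := by
  rw [sub_eq_integral, intervalIntegral.integral_congr (g := fun _ => 1)]
  · simp
  · intro x hx
    exact Real.smoothTransition.one_of_one_le ((one_le_div ha).2 ((le_min hs ht).trans hx.1))

theorem sub_le_self (ha : 0 < a) (s : ℝ) : s - a ≤ softRamp a s := by
  rcases le_total s a with hs | hs
  · exact (sub_nonpos.2 hs).trans (nonneg ha s)
  · linarith [sub_eq_of_le ha le_rfl hs, nonneg ha a]

theorem deriv_nonneg (s : ℝ) : 0 ≤ deriv (softRamp a) s := by
  rw [deriv_eq]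
  exact Real.smoothTransition.nonneg _

theorem deriv_le_one (s : ℝ) : deriv (softRamp a) s ≤ 1 := by
  rw [deriv_eq]
  exact Real.smoothTransition.le_one _

theorem deriv_eq_one (ha : 0 < a) {s : ℝ} (hs : a ≤ s) : deriv (softRamp a) s = 1 := by
  rw [deriv_eq]
  exact Real.smoothTransition.one_of_one_le ((one_le_div ha).2 hs)

theorem deriv_eq_zero (ha : 0 < a) {s : ℝ} (hs : s ≤ 0) : deriv (softRamp a) s = 0 := by
  rw [deriv_eq]
  exact Real.smoothTransition.zero_of_nonpos (div_nonpos_of_nonpos_of_nonneg hs ha.le)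

theorem contDiff_deriv (a : ℝ) : ContDiff ℝ (⊤ : ℕ∞) (deriv (softRamp a)) :=
  (contDiff_infty_iff_deriv.1 (contDiff a)).2

theorem hasDerivAt_deriv (a s : ℝ) :
    HasDerivAt (deriv (softRamp a)) (deriv (deriv (softRamp a)) s) s :=
  ((contDiff_deriv a).differentiable (by simp) s).hasDerivAt

theorem deriv_deriv_nonneg (ha : 0 < a) (s : ℝ) : 0 ≤ deriv (deriv (softRamp a)) s := by
  refine Monotone.deriv_nonneg ?_
  rw [deriv_eq]
  exact fun x y hxy => Real.smoothTransition.monotone (div_le_div_of_nonneg_right hxy ha.le)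

theorem deriv_deriv_eq_zero_of_neg (ha : 0 < a) {s : ℝ} (hs : s < 0) :
    deriv (deriv (softRamp a)) s = 0 := by
  have hconst : deriv (softRamp a) =ᶠ[𝓝 s] fun _ => 0 := by
    filter_upwards [Iio_mem_nhds hs] with t ht using deriv_eq_zero ha (le_of_lt ht)
  rw [hconst.deriv_eq, deriv_const]

theorem deriv_deriv_eq_zero_of_lt (ha : 0 < a) {s : ℝ} (hs : a < s) :
    deriv (deriv (softRamp a)) s = 0 := by
  have hconst : deriv (softRamp a) =ᶠ[𝓝 s] fun _ => 1 := by
    filter_upwards [Ioi_mem_nhds hs] with t ht using deriv_eq_one ha (le_of_lt ht)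
  rw [hconst.deriv_eq, deriv_const]

end softRamp

/-! ### A smooth approximation of `log (max ε |y - z|)` -/

/-- A smooth radial function, equal to `log (|y - z| / ε)` up to a constant when
`|y - z| ≥ ε e⁻ᵇ`, and vanishing when `|y - z| ≤ ε e⁻²ᵇ`. The value at `y = z` is prescribed
separately because `log 0 = 0` in Mathlib. -/
def logRamp (z : ℂ) (ε b : ℝ) (y : ℂ) : ℝ :=
  if y = z then 0 else softRamp b (Real.log (‖y - z‖ / ε) + 2 * b)

/-- The radial profile of the Laplacian of `logRamp`, as a function of `r = |y - z|`. -/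
def logRampWeight (ε b r : ℝ) : ℝ :=
  deriv (deriv (softRamp b)) (Real.log (r / ε) + 2 * b) / r ^ 2

/-- The Laplacian of `logRamp`: a smooth version of `2π` times the uniform probability measure
on the circle `|y - z| = ε`. -/
def logRampDensity (z : ℂ) (ε b : ℝ) (y : ℂ) : ℝ := logRampWeight ε b ‖y - z‖

section Log

theorem log_div_le_iff {ε r t : ℝ} (hε : 0 < ε) (hr : 0 < r) :
    Real.log (r / ε) ≤ t ↔ r ≤ ε * Real.exp t := by
  rw [Real.log_le_iff_le_exp (div_pos hr hε), div_le_iff₀' hε]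

theorem log_div_lt_iff {ε r t : ℝ} (hε : 0 < ε) (hr : 0 < r) :
    Real.log (r / ε) < t ↔ r < ε * Real.exp t := by
  rw [Real.log_lt_iff_lt_exp (div_pos hr hε), div_lt_iff₀' hε]

theorem mul_exp_neg_lt {ε b : ℝ} (hε : 0 < ε) (hb : 0 < b) : ε * Real.exp (-b) < ε :=
  mul_lt_of_lt_one_right hε (Real.exp_lt_one_iff.2 (neg_lt_zero.2 hb))

theorem log_norm_sub_div {E : Type*} [NormedAddCommGroup E] {ε : ℝ} {y z : E} (hε : 0 < ε)
    (hyz : y ≠ z) : Real.log (‖y - z‖ / ε) = Real.log ‖y - z‖ - Real.log ε :=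
  Real.log_div (norm_ne_zero_iff.2 (sub_ne_zero.2 hyz)) hε.ne'

theorem contDiffAt_log_norm_sub {E : Type*} [NormedAddCommGroup E] [InnerProductSpace ℝ E]
    {n : WithTop ℕ∞} {y z : E} (hyz : y ≠ z) :
    ContDiffAt ℝ n (fun w => Real.log ‖w - z‖) y :=
  ((contDiff_id.sub contDiff_const).contDiffAt.norm ℝ (sub_ne_zero.2 hyz)).log
    (norm_ne_zero_iff.2 (sub_ne_zero.2 hyz))

end Log

section LogRamp

variable {z : ℂ} {ε b : ℝ}

theorem logRamp_of_ne {y : ℂ} (hyz : y ≠ z) :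
    logRamp z ε b y = softRamp b (Real.log (‖y - z‖ / ε) + 2 * b) := if_neg hyz

theorem logRamp_nonneg (hb : 0 < b) (y : ℂ) : 0 ≤ logRamp z ε b y := by
  unfold logRamp
  split_ifs
  exacts [le_rfl, softRamp.nonneg hb _]

theorem logRamp_eventuallyEq_zero (hε : 0 < ε) (hb : 0 < b) : logRamp z ε b =ᶠ[𝓝 z] fun _ => 0 := by
  have hr : 0 < ε * Real.exp (-(2 * b)) := by positivity
  filter_upwards [Metric.ball_mem_nhds z hr] with y hy
  by_cases hyz : y = z
  · exact if_pos hyz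
  · have hlog := (log_div_lt_iff hε (norm_pos_iff.2 (sub_ne_zero.2 hyz))).2 (mem_ball_iff_norm.1 hy)
    rw [logRamp_of_ne hyz]
    exact softRamp.eq_zero hb (by linarith)

theorem logRamp_eventuallyEq (hε : 0 < ε) {y : ℂ} (hyz : y ≠ z) :
    logRamp z ε b =ᶠ[𝓝 y]
      fun w => softRamp b (Real.log ‖w - z‖ + (2 * b - Real.log ε)) := by
  filter_upwards [isOpen_ne.mem_nhds hyz] with w hw
  rw [logRamp_of_ne hw, log_norm_sub_div hε hw]
  ring_nf

theorem contDiff_logRamp (hε : 0 < ε) (hb : 0 < b) : ContDiff ℝ (⊤ : ℕ∞) (logRamp z ε b) := by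
  refine contDiff_iff_contDiffAt.2 fun y => ?_
  by_cases hyz : y = z
  · subst hyz
    exact contDiffAt_const.congr_of_eventuallyEq (logRamp_eventuallyEq_zero hε hb)
  · refine ContDiffAt.congr_of_eventuallyEq ?_ (logRamp_eventuallyEq hε hyz)
    exact (softRamp.contDiff b).contDiffAt.comp y
      ((contDiffAt_log_norm_sub hyz).add contDiffAt_const)

theorem contDiff_two_logRamp (hε : 0 < ε) (hb : 0 < b) : ContDiff ℝ 2 (logRamp z ε b) :=
  contDiff_infty.1 (contDiff_logRamp hε hb) 2

theorem laplacian_logRamp (hε : 0 < ε) (hb : 0 < b) :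
    laplacian (logRamp z ε b) = logRampDensity z ε b := by
  funext y
  by_cases hyz : y = z
  · subst hyz
    rw [(InnerProductSpace.laplacian_congr_nhds (logRamp_eventuallyEq_zero hε hb)).eq_of_nhds]
    simp [logRampDensity, logRampWeight]
  · rw [(InnerProductSpace.laplacian_congr_nhds (logRamp_eventuallyEq hε hyz)).eq_of_nhds,
      laplacian_comp_add_const (softRamp.contDiff_two b) (contDiffAt_log_norm_sub hyz),
      laplacian_log_norm_sub hyz, norm_gradient_log_norm_sub hyz, logRampDensity, logRampWeight,
      log_norm_sub_div hε hyz, mul_zero, zero_add, inv_pow, ← div_eq_mul_inv]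
    ring_nf

theorem continuous_logRampDensity (hε : 0 < ε) (hb : 0 < b) :
    Continuous (logRampDensity z ε b) := by
  rw [← laplacian_logRamp hε hb]
  exact continuous_laplacian (contDiff_two_logRamp hε hb)

theorem logRampWeight_nonneg (hb : 0 < b) (r : ℝ) : 0 ≤ logRampWeight ε b r :=
  div_nonneg (softRamp.deriv_deriv_nonneg hb _) (sq_nonneg r)

theorem logRampDensity_nonneg (hb : 0 < b) (y : ℂ) : 0 ≤ logRampDensity z ε b y :=
  logRampWeight_nonneg hb _

theorem mem_Icc_of_logRampWeight_ne_zero (hε : 0 < ε) (hb : 0 < b) {r : ℝ} (hr : 0 ≤ r)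
    (hne : logRampWeight ε b r ≠ 0) :
    r ∈ Set.Icc (ε * Real.exp (-(2 * b))) (ε * Real.exp (-b)) := by
  obtain ⟨hnum, hden⟩ := div_ne_zero_iff.1 hne
  have hpos : 0 < r := hr.lt_of_ne' (ne_zero_pow two_ne_zero hden)
  constructor
  · by_contra! hlt
    have := (log_div_lt_iff hε hpos).2 hlt
    exact hnum (softRamp.deriv_deriv_eq_zero_of_neg hb (by linarith))
  · by_contra! hlt
    have := not_le.1 (mt (log_div_le_iff hε hpos).1 (not_le.2 hlt))
    exact hnum (softRamp.deriv_deriv_eq_zero_of_lt hb (by linarith))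

theorem norm_sub_lt_of_logRampDensity_ne_zero (hε : 0 < ε) (hb : 0 < b) {y : ℂ}
    (hy : logRampDensity z ε b y ≠ 0) : ‖y - z‖ < ε :=
  (mem_Icc_of_logRampWeight_ne_zero hε hb (norm_nonneg _) hy).2.trans_lt (mul_exp_neg_lt hε hb)

theorem tsupport_logRampDensity_subset_closedBall (hε : 0 < ε) (hb : 0 < b) :
    tsupport (logRampDensity z ε b) ⊆ Metric.closedBall z (ε * Real.exp (-b)) :=
  closure_minimal (fun _ hy => mem_closedBall_iff_norm.2
    (mem_Icc_of_logRampWeight_ne_zero hε hb (norm_nonneg _) hy).2) Metric.isClosed_closedBall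

theorem tsupport_logRampDensity_subset_ball (hε : 0 < ε) (hb : 0 < b) :
    tsupport (logRampDensity z ε b) ⊆ Metric.ball z ε :=
  (tsupport_logRampDensity_subset_closedBall hε hb).trans
    (Metric.closedBall_subset_ball (mul_exp_neg_lt hε hb))

theorem hasCompactSupport_logRampDensity (hε : 0 < ε) (hb : 0 < b) :
    HasCompactSupport (logRampDensity z ε b) :=
  (isCompact_closedBall z _).of_isClosed_subset (isClosed_tsupport _)
    (tsupport_logRampDensity_subset_closedBall hε hb)

theorem integrable_logRampDensity (hε : 0 < ε) (hb : 0 < b) : Integrable (logRampDensity z ε b) :=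
  (continuous_logRampDensity hε hb).integrable_of_hasCompactSupport
    (hasCompactSupport_logRampDensity hε hb)

theorem hasDerivAt_deriv_softRamp_log (hε : 0 < ε) {r : ℝ} (hr : 0 < r) :
    HasDerivAt (fun r => deriv (softRamp b) (Real.log (r / ε) + 2 * b))
      (r * logRampWeight ε b r) r := by
  have hlog : HasDerivAt (fun r => Real.log (r / ε) + 2 * b) (1 / ε / (r / ε)) r :=
    (((hasDerivAt_id r).div_const ε).log (div_pos hr hε).ne').add_const (2 * b)
  refine ((softRamp.hasDerivAt_deriv b _).comp r hlog).congr_deriv ?_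
  rw [logRampWeight]
  field_simp

theorem integral_mul_logRampWeight (hε : 0 < ε) (hb : 0 < b) :
    ∫ r in Set.Ioi (0 : ℝ), r * logRampWeight ε b r = 1 := by
  set r₁ := ε * Real.exp (-(2 * b)) with hr₁_def
  have hr₁ : 0 < r₁ := by positivity
  have hzero : ∀ r ∈ Set.Ioi 0 \ Set.Ici r₁, r * logRampWeight ε b r = 0 := by
    rintro r ⟨hr, hrr₁⟩
    by_contra hne
    exact hrr₁ (mem_Icc_of_logRampWeight_ne_zero hε hb (le_of_lt hr) (right_ne_zero_of_mul hne)).1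
  have hlim : Tendsto (fun r => deriv (softRamp b) (Real.log (r / ε) + 2 * b)) atTop (𝓝 1) := by
    refine tendsto_const_nhds.congr' ?_
    filter_upwards [eventually_ge_atTop ε] with r hr
    have := Real.log_nonneg ((one_le_div hε).2 hr)
    rw [softRamp.deriv_eq_one hb (by linarith)]
  have hstart : Real.log (r₁ / ε) + 2 * b = 0 := by
    rw [hr₁_def, mul_div_cancel_left₀ _ hε.ne', Real.log_exp, neg_add_cancel]
  rw [setIntegral_eq_of_subset_of_forall_sdiff_eq_zero measurableSet_Ioi
      (Set.Ici_subset_Ioi.2 hr₁) hzero, integral_Ici_eq_integral_Ioi,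
    integral_Ioi_of_hasDerivAt_of_nonneg'
      (fun r hr => hasDerivAt_deriv_softRamp_log hε (hr₁.trans_le hr))
      (fun r hr => mul_nonneg (hr₁.trans hr).le (logRampWeight_nonneg hb r)) hlim,
    hstart, softRamp.deriv_eq_zero hb le_rfl, sub_zero]

theorem continuous_mul_of_tsupport_subset {X : Type*} [TopologicalSpace X] {U : Set X}
    (hU : IsOpen U) {u v : X → ℝ} (hu : ContinuousOn u U) (hv : Continuous v)
    (hvU : tsupport v ⊆ U) : Continuous fun y => u y * v y := by
  refine continuous_of_tsupport fun y hy => ?_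
  have hyU : y ∈ U := hvU (tsupport_mul_subset_right hy)
  exact (hu.continuousAt (hU.mem_nhds hyU)).mul hv.continuousAt

theorem integrable_mul_logRampDensity (hε : 0 < ε) (hb : 0 < b) {u : ℂ → ℝ}
    (hu : ContinuousOn u (Metric.ball z ε)) : Integrable fun y => u y * logRampDensity z ε b y :=
  (continuous_mul_of_tsupport_subset Metric.isOpen_ball hu (continuous_logRampDensity hε hb)
    (tsupport_logRampDensity_subset_ball hε hb)).integrable_of_hasCompactSupport
    (hasCompactSupport_logRampDensity hε hb).mul_left

theorem integral_mul_logRampDensity (hε : 0 < ε) (hb : 0 < b) {u : ℂ → ℝ}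
    (hu : InnerProductSpace.HarmonicOnNhd u (Metric.ball z ε)) :
    ∫ y, u y * logRampDensity z ε b y = 2 * Real.pi * u z := by
  have hmean : ∀ r ∈ Set.Ioi (0 : ℝ), (r * logRampWeight ε b r) • Real.circleAverage u z r =
      (r * logRampWeight ε b r) • u z := by
    intro r (hr : 0 < r)
    by_cases hw : logRampWeight ε b r = 0
    · simp [hw]
    · have hrε : r < ε :=
        (mem_Icc_of_logRampWeight_ne_zero hε hb hr.le hw).2.trans_lt (mul_exp_neg_lt hε hb)
      rw [InnerProductSpace.HarmonicOnNhd.circleAverage_eq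
        (hu.mono (Metric.closedBall_subset_ball (by rwa [abs_of_pos hr])))]
  have hint : Integrable fun y => logRampWeight ε b ‖y - z‖ • u y :=
    (integrable_mul_logRampDensity hε hb hu.continuousOn).congr
      (.of_forall fun y => mul_comm _ _)
  calc ∫ y, u y * logRampDensity z ε b y = ∫ y, logRampWeight ε b ‖y - z‖ • u y :=
        integral_congr_ae (.of_forall fun y => mul_comm _ _)
    _ = (2 * Real.pi) • ∫ r in Set.Ioi 0, (r * logRampWeight ε b r) • u z := by
        rw [integral_norm_sub_smul hint, setIntegral_congr_fun measurableSet_Ioi hmean]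
    _ = 2 * Real.pi * u z := by
        rw [integral_smul_const, integral_mul_logRampWeight hε hb, one_smul, smul_eq_mul]

theorem integral_logRampDensity (hε : 0 < ε) (hb : 0 < b) :
    ∫ y, logRampDensity z ε b y = 2 * Real.pi := by
  simpa using integral_mul_logRampDensity (z := z) hε hb
    (InnerProductSpace.harmonicOnNhd_const (1 : ℝ))

theorem logRamp_sub_eq_log (hε : 0 < ε) (hb : 0 < b) {y : ℂ} (hy : ε ≤ ‖y - z‖) :
    logRamp z ε b y - softRamp b (2 * b) = Real.log (‖y - z‖ / ε) := by
  have hyz : y ≠ z := by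
    rintro rfl
    exact hε.not_ge (by simpa using hy)
  have hlog : 0 ≤ Real.log (‖y - z‖ / ε) := Real.log_nonneg ((one_le_div hε).2 hy)
  rw [logRamp_of_ne hyz, softRamp.sub_eq_of_le hb (by linarith) (by linarith), add_sub_cancel_right]

theorem logRamp_sub_le (hε : 0 < ε) (hb : 0 < b) (y : ℂ) :
    logRamp z ε b y - softRamp b (2 * b) ≤ Real.log (max ε ‖z - y‖ / ε) := by
  rw [norm_sub_rev]
  rcases lt_or_ge ‖y - z‖ ε with h | h
  · rw [max_eq_left h.le, div_self hε.ne', Real.log_one, sub_nonpos]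
    by_cases hyz : y = z
    · rw [logRamp, if_pos hyz]
      exact softRamp.nonneg hb _
    · have hlog : Real.log (‖y - z‖ / ε) < 0 :=
        (log_div_lt_iff hε (norm_pos_iff.2 (sub_ne_zero.2 hyz))).2 (by simpa using h)
      rw [logRamp_of_ne hyz]
      exact softRamp.monotone b (by linarith)
  · rw [max_eq_right h, logRamp_sub_eq_log hε hb h]

theorem le_logRamp_sub (hε : 0 < ε) (hb : 0 < b) (y : ℂ) :
    Real.log (max ε ‖z - y‖ / ε) - 2 * b ≤ logRamp z ε b y - softRamp b (2 * b) := by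
  rw [norm_sub_rev]
  rcases lt_or_ge ‖y - z‖ ε with h | h
  · rw [max_eq_left h.le, div_self hε.ne', Real.log_one]
    linarith [logRamp_nonneg (z := z) (ε := ε) hb y,
      softRamp.le_self hb (s := 2 * b) (by linarith)]
  · rw [max_eq_right h, logRamp_sub_eq_log hε hb h]
    linarith

theorem log_le_logRamp_sub (hb : 0 < b) {y : ℂ} (hyz : y ≠ z) :
    Real.log (‖y - z‖ / ε) ≤ logRamp z ε b y - softRamp b (2 * b) := by
  rw [logRamp_of_ne hyz]
  rcases le_total (Real.log (‖y - z‖ / ε)) 0 with h | h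
  · have := softRamp.sub_le_sub (a := b) (s := Real.log (‖y - z‖ / ε) + 2 * b) (t := 2 * b)
      (by linarith)
    linarith
  · rw [softRamp.sub_eq_of_le hb (by linarith) (by linarith)]
    linarith

end LogRamp

/-! ### Series of independent random variables -/

section IndependentSeries

open scoped NNReal

variable {Ω : Type*} [MeasurableSpace Ω] {P : Measure Ω} {X Z : Ω → ℝ}
  {Y : ℕ → Ω → ℝ} {v : ℕ → ℝ≥0}

theorem eLpNorm_one_le_one_add_variance [IsProbabilityMeasure P] (hX : MemLp X 2 P)
    (hmean : ∫ ω, X ω ∂P = 0) : eLpNorm X 1 P ≤ ENNReal.ofReal (1 + variance X P) := by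
  have hX_int : Integrable X P := hX.integrable one_le_two
  rw [eLpNorm_one_eq_lintegral_enorm, ← ofReal_integral_norm_eq_lintegral_enorm hX_int,
    variance_of_integral_eq_zero hX.aemeasurable hmean]
  refine ENNReal.ofReal_le_ofReal ?_
  calc ∫ ω, ‖X ω‖ ∂P ≤ ∫ ω, (1 + X ω ^ 2) ∂P := by
        refine integral_mono hX_int.norm ((integrable_const 1).add hX.integrable_sq) fun ω => ?_
        rw [Real.norm_eq_abs]
        nlinarith [sq_nonneg (|X ω| - 1), sq_abs (X ω), abs_nonneg (X ω)]
    _ = 1 + ∫ ω, X ω ^ 2 ∂P := by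
        rw [integral_add (integrable_const 1) hX.integrable_sq]
        simp

theorem martingale_sum_of_iIndepFun (hY : iIndepFun Y P) (hm : ∀ n, StronglyMeasurable (Y n))
    (hint : ∀ n, Integrable (Y n) P) (hmean : ∀ n, ∫ ω, Y n ω ∂P = 0) :
    Martingale (fun N ω => ∑ n ∈ Finset.range (N + 1), Y n ω) (Filtration.natural Y hm) P := by
  have := hY.isProbabilityMeasure
  refine martingale_of_condExp_sub_eq_zero_nat (fun N => ?_)
    (fun N => integrable_finsetSum _ fun n _ => hint n) fun N => ?_
  · exact Finset.stronglyMeasurable_fun_sum _ fun n hn =>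
      (Filtration.stronglyAdapted_natural hm n).mono
        ((Filtration.natural Y hm).mono (Nat.lt_succ_iff.1 (Finset.mem_range.1 hn)))
  · have hincrement : ((fun ω => ∑ n ∈ Finset.range (N + 1 + 1), Y n ω) -
        fun ω => ∑ n ∈ Finset.range (N + 1), Y n ω) = Y (N + 1) := by
      funext ω
      simp [Finset.sum_range_succ _ (N + 1)]
    rw [hincrement]
    refine (hY.condExp_natural_ae_eq_of_lt hm (Nat.lt_succ_self N)).trans ?_
    rw [hmean]
    rfl

theorem eLpNorm_one_sum_le_of_iIndepFun (hY : iIndepFun Y P) (hL2 : ∀ n, MemLp (Y n) 2 P)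
    (hmean : ∀ n, ∫ ω, Y n ω ∂P = 0) (hvar : Summable fun n => variance (Y n) P)
    (s : Finset ℕ) :
    eLpNorm (fun ω => ∑ n ∈ s, Y n ω) 1 P ≤ ENNReal.ofReal (1 + ∑' n, variance (Y n) P) := by
  have := hY.isProbabilityMeasure
  have hsum_mean : ∫ ω, ∑ n ∈ s, Y n ω ∂P = 0 := by
    rw [integral_finsetSum _ fun n _ => (hL2 n).integrable one_le_two]
    exact Finset.sum_eq_zero fun n _ => hmean n
  have hsum_var : variance (fun ω => ∑ n ∈ s, Y n ω) P = ∑ n ∈ s, variance (Y n) P := by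
    rw [← IndepFun.variance_sum (fun n _ => hL2 n) fun i _ j _ hij => hY.indepFun hij]
    congr 1
    funext ω
    simp
  refine (eLpNorm_one_le_one_add_variance (memLp_finsetSum s fun n _ => hL2 n) hsum_mean).trans ?_
  rw [hsum_var]
  gcongr
  exact hvar.sum_le_tsum s fun n _ => variance_nonneg _ _

theorem ae_exists_tendsto_sum_of_stronglyMeasurable (hY : iIndepFun Y P)
    (hm : ∀ n, StronglyMeasurable (Y n)) (hL2 : ∀ n, MemLp (Y n) 2 P)
    (hmean : ∀ n, ∫ ω, Y n ω ∂P = 0) (hvar : Summable fun n => variance (Y n) P) :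
    ∀ᵐ ω ∂P, ∃ l, Tendsto (fun N => ∑ n ∈ Finset.range N, Y n ω) atTop (𝓝 l) := by
  have := hY.isProbabilityMeasure
  have hmart := martingale_sum_of_iIndepFun hY hm (fun n => (hL2 n).integrable one_le_two) hmean
  filter_upwards [hmart.submartingale.exists_ae_tendsto_of_bdd
    fun N => eLpNorm_one_sum_le_of_iIndepFun hY hL2 hmean hvar _] with ω ⟨l, hl⟩
  exact ⟨l, (tendsto_add_atTop_iff_nat 1).1 hl⟩

theorem ae_exists_tendsto_sum_of_summable_variance (hY : iIndepFun Y P)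
    (hL2 : ∀ n, MemLp (Y n) 2 P) (hmean : ∀ n, ∫ ω, Y n ω ∂P = 0)
    (hvar : Summable fun n => variance (Y n) P) :
    ∀ᵐ ω ∂P, ∃ l, Tendsto (fun N => ∑ n ∈ Finset.range N, Y n ω) atTop (𝓝 l) := by
  have hmk := fun n => (hL2 n).aemeasurable.ae_eq_mk
  filter_upwards [ae_exists_tendsto_sum_of_stronglyMeasurable (hY.congr hmk)
    (fun n => (hL2 n).aemeasurable.measurable_mk.stronglyMeasurable)
    (fun n => (hL2 n).ae_eq (hmk n)) (fun n => (integral_congr_ae (hmk n)).symm.trans (hmean n))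
    (hvar.congr fun n => variance_congr (hmk n)), ae_all_iff.2 hmk] with ω ⟨l, hl⟩ hω
  exact ⟨l, hl.congr fun N => Finset.sum_congr rfl fun n _ => (hω n).symm⟩

theorem hasLaw_sum_gaussian (hY : iIndepFun Y P)
    (hlaw : ∀ n, HasLaw (Y n) (gaussianReal 0 (v n)) P) (N : ℕ) :
    HasLaw (fun ω => ∑ n ∈ Finset.range N, Y n ω)
      (gaussianReal 0 (∑ n ∈ Finset.range N, v n)) P := by
  have := hY.isProbabilityMeasure
  induction N with
  | zero =>
    simp only [Finset.range_zero, Finset.sum_empty, gaussianReal_zero_var]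
    exact ⟨aemeasurable_const, by simp⟩
  | succ N ih =>
    have hindep : IndepFun (fun ω => ∑ n ∈ Finset.range N, Y n ω) (Y N) P := by
      simpa only [← Finset.sum_apply] using
        hY.indepFun_finsetSum_of_notMem₀ (fun n => (hlaw n).aemeasurable) (by simp)
    simp only [Finset.sum_range_succ]
    refine ⟨ih.aemeasurable.add (hlaw N).aemeasurable, ?_⟩
    exact (gaussianReal_add_gaussianReal_of_indepFun hindep ih.map_eq (hlaw N).map_eq).trans
      (by rw [add_zero])

theorem memLp_two_of_hasLaw_gaussian {m : ℝ} {u : ℝ≥0} (hX : HasLaw X (gaussianReal m u) P) :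
    MemLp X 2 P := by
  have hid : MemLp id 2 (P.map X) := hX.map_eq ▸ memLp_id_gaussianReal 2
  exact hid.comp_of_map hX.aemeasurable

theorem ae_exists_tendsto_sum_gaussian (hY : iIndepFun Y P)
    (hlaw : ∀ n, HasLaw (Y n) (gaussianReal 0 (v n)) P) (hv : Summable v) :
    ∀ᵐ ω ∂P, ∃ l, Tendsto (fun N => ∑ n ∈ Finset.range N, Y n ω) atTop (𝓝 l) := by
  refine ae_exists_tendsto_sum_of_summable_variance hY
    (fun n => memLp_two_of_hasLaw_gaussian (hlaw n)) (fun n => ?_) ?_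
  · rw [(hlaw n).integral_eq, integral_id_gaussianReal]
  · simp only [(hlaw _).variance_eq, variance_id_gaussianReal]
    exact NNReal.summable_coe.2 hv

theorem tendsto_charFun_gaussianReal (m : ℝ) {u : ℕ → ℝ≥0} {w : ℝ≥0}
    (hu : Tendsto u atTop (𝓝 w)) (t : ℝ) :
    Tendsto (fun n => charFun (gaussianReal m (u n)) t) atTop
      (𝓝 (charFun (gaussianReal m w) t)) := by
  simp only [charFun_gaussianReal]
  have hcont : Continuous fun x : ℝ≥0 =>
      Complex.exp (t * m * Complex.I - (x : ℝ) * t ^ 2 / 2) := by fun_prop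
  exact (hcont.tendsto w).comp hu

theorem hasLaw_gaussian_of_tendsto_sum (hY : iIndepFun Y P)
    (hlaw : ∀ n, HasLaw (Y n) (gaussianReal 0 (v n)) P) (hv : Summable v)
    (hZ : ∀ᵐ ω ∂P, Tendsto (fun N => ∑ n ∈ Finset.range N, Y n ω) atTop (𝓝 (Z ω))) :
    HasLaw Z (gaussianReal 0 (∑' n, v n)) P := by
  have := hY.isProbabilityMeasure
  have hsum_law := hasLaw_sum_gaussian hY hlaw
  have hZ_meas : AEMeasurable Z P :=
    aemeasurable_of_tendsto_metrizable_ae atTop (fun N => (hsum_law N).aemeasurable) hZ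
  have := Measure.isProbabilityMeasure_map hZ_meas
  have hdistr :=
    tendstoInDistribution_of_ae_tendsto (fun N => (hsum_law N).aemeasurable) hZ_meas hZ
  refine ⟨hZ_meas, Measure.ext_of_charFun (funext fun t => ?_)⟩
  have hcharFun := ProbabilityMeasure.tendsto_iff_tendsto_charFun.1 hdistr.tendsto t
  simp only [ProbabilityMeasure.coe_mk, (hsum_law _).map_eq] at hcharFun
  exact tendsto_nhds_unique hcharFun (tendsto_charFun_gaussianReal 0 hv.hasSum.tendsto_sum_nat t)

end IndependentSeries

/-! ### Pairing the field with a function -/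

namespace GFF

variable {D : Opens ℂ} {Ω : Type*} [MeasurableSpace Ω] {P : Measure Ω}

theorem iIndepFun_coeff_mul (h : GFF D P) (f : H1 D) :
    iIndepFun (fun n ω => h.coeff n ω * h.basis.repr f n) P :=
  h.indep.comp (fun n x => x * h.basis.repr f n) fun _ => by fun_prop

theorem hasLaw_coeff_mul (h : GFF D P) (f : H1 D) (n : ℕ) :
    HasLaw (fun ω => h.coeff n ω * h.basis.repr f n)
      (gaussianReal 0 (‖h.basis.repr f n‖₊ ^ 2)) P := by
  convert gaussianReal_mul_const (h.law n) (h.basis.repr f n) using 2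
  · simp
  · ext
    simp

theorem summable_nnnorm_repr_sq (h : GFF D P) (f : H1 D) :
    Summable fun n => ‖h.basis.repr f n‖₊ ^ 2 := by
  rw [← NNReal.summable_coe]
  simpa using (lp.memℓp (h.basis.repr f)).summable (by simp)

theorem tsum_nnnorm_repr_sq (h : GFF D P) (f : H1 D) :
    ((∑' n, ‖h.basis.repr f n‖₊ ^ 2 : NNReal) : ℝ) = ‖f‖ ^ 2 := by
  have hParseval := lp.norm_rpow_eq_tsum (p := 2) (by simp) (h.basis.repr f)
  rw [LinearIsometryEquiv.norm_map] at hParseval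
  rw [NNReal.coe_tsum]
  simpa using hParseval.symm

theorem ae_tendsto_pairing (h : GFF D P) (f : H1 D) :
    ∀ᵐ ω ∂P, Tendsto (fun N => h.partialPairing f N ω) atTop (𝓝 (h.pairing f ω)) := by
  filter_upwards [ae_exists_tendsto_sum_gaussian (h.iIndepFun_coeff_mul f) (h.hasLaw_coeff_mul f)
    (h.summable_nnnorm_repr_sq f)] with ω hω
  exact tendsto_nhds_limUnder hω

theorem hasLaw_pairing (h : GFF D P) (f : H1 D) :
    HasLaw (h.pairing f) (gaussianReal 0 (∑' n, ‖h.basis.repr f n‖₊ ^ 2)) P :=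
  hasLaw_gaussian_of_tendsto_sum (h.iIndepFun_coeff_mul f) (h.hasLaw_coeff_mul f)
    (h.summable_nnnorm_repr_sq f) (h.ae_tendsto_pairing f)

theorem memLp_pairing (h : GFF D P) (f : H1 D) : MemLp (h.pairing f) 2 P :=
  memLp_two_of_hasLaw_gaussian (h.hasLaw_pairing f)

theorem variance_pairing (h : GFF D P) (f : H1 D) : variance (h.pairing f) P = ‖f‖ ^ 2 := by
  rw [(h.hasLaw_pairing f).variance_eq, variance_id_gaussianReal, tsum_nnnorm_repr_sq]

end GFF

/-! ### Test functions approximating the truncated Green's function -/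

/-- The Green's function `H y - log |y - z|` truncated on the disk of radius `ε` about its pole;
for the correction `H` of the Green's function of `D` this is `regGreen D ε z` on `D`. -/
def truncGreen (H : ℂ → ℝ) (ε : ℝ) (z y : ℂ) : ℝ := Real.log (1 / max ε ‖z - y‖) + H y

/-- A version of `truncGreen` that is smooth on `D`, above it by at most `2b`: the kink at
`|y - z| = ε` is rounded off by `logRamp`. -/
def smoothGreen (H : ℂ → ℝ) (ε : ℝ) (z : ℂ) (b : ℝ) (y : ℂ) : ℝ :=
  H y - Real.log ε - (logRamp z ε b y - softRamp b (2 * b))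

open Classical in
/-- A smooth and compactly supported version of `truncGreen`, within `2b` of it: `smoothGreen` is
cut off below the level `b` by `softRamp`. -/
def approxGreen (D : Opens ℂ) (H : ℂ → ℝ) (ε : ℝ) (z : ℂ) (b : ℝ) (y : ℂ) : ℝ :=
  if y ∈ D then softRamp b (smoothGreen H ε z b y - b) else 0

section Approximation

variable {D : Opens ℂ} {H : ℂ → ℝ} {ε b : ℝ} {z y : ℂ}

theorem truncGreen_eq (hε : 0 < ε) (z y : ℂ) :
    truncGreen H ε z y = H y - Real.log ε - Real.log (max ε ‖z - y‖ / ε) := by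
  rw [truncGreen, one_div, Real.log_inv, Real.log_div (lt_max_of_lt_left hε).ne' hε.ne']
  ring

theorem truncGreen_of_norm_le (hy : ‖y - z‖ ≤ ε) : truncGreen H ε z y = H y - Real.log ε := by
  rw [truncGreen, norm_sub_rev, max_eq_left hy, one_div, Real.log_inv]
  ring

theorem truncGreen_of_le_norm (hy : ε ≤ ‖y - z‖) :
    truncGreen H ε z y = H y - Real.log ‖y - z‖ := by
  rw [truncGreen, norm_sub_rev, max_eq_right hy, one_div, Real.log_inv]
  ring

theorem truncGreen_le_smoothGreen (hε : 0 < ε) (hb : 0 < b) (y : ℂ) :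
    truncGreen H ε z y ≤ smoothGreen H ε z b y := by
  rw [truncGreen_eq hε, smoothGreen]
  linarith [logRamp_sub_le (z := z) hε hb y]

theorem smoothGreen_le_truncGreen_add (hε : 0 < ε) (hb : 0 < b) (y : ℂ) :
    smoothGreen H ε z b y ≤ truncGreen H ε z y + 2 * b := by
  rw [truncGreen_eq hε, smoothGreen]
  linarith [le_logRamp_sub (z := z) hε hb y]

theorem smoothGreen_le (hε : 0 < ε) (hb : 0 < b) (hyz : y ≠ z) :
    smoothGreen H ε z b y ≤ H y - Real.log ‖y - z‖ := by
  have hlog := log_le_logRamp_sub (ε := ε) hb hyz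
  rw [log_norm_sub_div hε hyz] at hlog
  rw [smoothGreen]
  linarith

theorem approxGreen_of_mem (hy : y ∈ D) :
    approxGreen D H ε z b y = softRamp b (smoothGreen H ε z b y - b) := if_pos hy

theorem approxGreen_of_notMem (hy : y ∉ D) : approxGreen D H ε z b y = 0 := if_neg hy

theorem approxGreen_nonneg (hb : 0 < b) (y : ℂ) : 0 ≤ approxGreen D H ε z b y := by
  by_cases hy : y ∈ D
  · exact (approxGreen_of_mem hy).symm ▸ softRamp.nonneg hb _
  · exact (approxGreen_of_notMem hy).ge

theorem approxGreen_eventuallyEq (hy : y ∈ D) :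
    approxGreen D H ε z b =ᶠ[𝓝 y] fun w => softRamp b (smoothGreen H ε z b w + -b) := by
  filter_upwards [D.isOpen.mem_nhds hy] with w hw
  rw [approxGreen_of_mem hw, sub_eq_add_neg]

end Approximation

namespace IsGreenCorrection

variable {D : Opens ℂ} {z y : ℂ} {H : ℂ → ℝ} {ε b : ℝ}

theorem log_le_of_mem_ball (hH : IsGreenCorrection D z H) (hε : 0 < ε)
    (hball : Metric.ball z ε ⊆ D) (hy : y ∈ Metric.ball z ε) : Real.log ε ≤ H y := by
  have hharm : InnerProductSpace.HarmonicOnNhd (fun y => Real.log ε - H y) (Metric.ball z ε) :=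
    (InnerProductSpace.harmonicOnNhd_const (Real.log ε)).sub (hH.harmonic.mono hball)
  refine sub_nonpos.1 (nonpos_of_harmonicOnNhd Metric.isOpen_ball hharm (fun δ hδ => ?_) y hy)
  refine ⟨Metric.closedBall z (ε * Real.exp (-δ)), isCompact_closedBall _ _,
    Metric.closedBall_subset_ball (mul_exp_neg_lt hε hδ), fun w hw hδw => ?_⟩
  rw [mem_closedBall_iff_norm]
  rcases eq_or_ne w z with rfl | hwz
  · rw [sub_self, norm_zero]
    positivity
  · rw [← log_div_le_iff hε (norm_pos_iff.2 (sub_ne_zero.2 hwz)), log_norm_sub_div hε hwz]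
    linarith [hH.log_norm_sub_le (hball hw) hwz]

theorem truncGreen_nonneg (hH : IsGreenCorrection D z H) (hε : 0 < ε)
    (hball : Metric.ball z ε ⊆ D) (hy : y ∈ D) : 0 ≤ truncGreen H ε z y := by
  rcases lt_or_ge ‖y - z‖ ε with hlt | hge
  · rw [truncGreen_of_norm_le hlt.le]
    exact sub_nonneg.2 (hH.log_le_of_mem_ball hε hball (mem_ball_iff_norm.2 hlt))
  · rw [truncGreen_of_le_norm hge]
    exact sub_nonneg.2
      (hH.log_norm_sub_le hy (sub_ne_zero.1 (norm_pos_iff.1 (hε.trans_le hge))))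

theorem abs_approxGreen_sub_le (hH : IsGreenCorrection D z H) (hε : 0 < ε)
    (hball : Metric.ball z ε ⊆ D) (hb : 0 < b) (hy : y ∈ D) :
    |approxGreen D H ε z b y - truncGreen H ε z y| ≤ 2 * b := by
  have hnonneg := hH.truncGreen_nonneg hε hball hy
  have hlower := truncGreen_le_smoothGreen (H := H) (z := z) hε hb y
  have hupper := smoothGreen_le_truncGreen_add (H := H) (z := z) hε hb y
  have hramp := softRamp.sub_le_self hb (smoothGreen H ε z b y - b)
  rw [approxGreen_of_mem hy, abs_le]
  refine ⟨by linarith, ?_⟩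
  rcases le_total (smoothGreen H ε z b y - b) 0 with hle | hge
  · rw [softRamp.eq_zero hb hle]
    linarith
  · linarith [softRamp.le_self hb hge]

theorem exists_isCompact_approxGreen_eq_zero (hH : IsGreenCorrection D z H) (hε : 0 < ε)
    (hb : 0 < b) : ∃ K, IsCompact K ∧ K ⊆ (D : Set ℂ) ∧ ∀ y ∉ K, approxGreen D H ε z b y = 0 := by
  obtain ⟨K, hK, hKD, hlt⟩ := hH.exists_isCompact_lt hb
  refine ⟨insert z K, hK.insert z, Set.insert_subset hH.mem hKD, fun y hy => ?_⟩
  rw [Set.mem_insert_iff, not_or] at hy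
  by_cases hyD : y ∈ D
  · rw [approxGreen_of_mem hyD]
    exact softRamp.eq_zero hb
      (by linarith [smoothGreen_le (H := H) hε hb hy.1, hlt y hyD hy.2])
  · exact approxGreen_of_notMem hyD

theorem tsupport_approxGreen_subset (hH : IsGreenCorrection D z H) (hε : 0 < ε) (hb : 0 < b) :
    tsupport (approxGreen D H ε z b) ⊆ D := by
  obtain ⟨K, hK, hKD, hzero⟩ := hH.exists_isCompact_approxGreen_eq_zero hε hb
  exact (closure_minimal (Function.support_subset_iff'.2 hzero) hK.isClosed).trans hKD

theorem hasCompactSupport_approxGreen (hH : IsGreenCorrection D z H) (hε : 0 < ε) (hb : 0 < b) :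
    HasCompactSupport (approxGreen D H ε z b) := by
  obtain ⟨K, hK, -, hzero⟩ := hH.exists_isCompact_approxGreen_eq_zero hε hb
  exact HasCompactSupport.intro hK hzero

theorem contDiffAt_smoothGreen (hH : IsGreenCorrection D z H) (hε : 0 < ε) (hb : 0 < b)
    (hy : y ∈ D) : ContDiffAt ℝ (⊤ : ℕ∞) (smoothGreen H ε z b) y :=
  ((HarmonicAt.analyticAt (hH.harmonic y hy)).contDiffAt.sub contDiffAt_const).sub
    ((contDiff_logRamp hε hb).contDiffAt.sub contDiffAt_const)

theorem contDiff_approxGreen (hH : IsGreenCorrection D z H) (hε : 0 < ε) (hb : 0 < b) :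
    ContDiff ℝ (⊤ : ℕ∞) (approxGreen D H ε z b) := by
  refine contDiff_iff_contDiffAt.2 fun y => ?_
  by_cases hy : y ∈ D
  · refine ContDiffAt.congr_of_eventuallyEq ?_ (approxGreen_eventuallyEq hy)
    exact (softRamp.contDiff b).contDiffAt.comp y
      ((hH.contDiffAt_smoothGreen hε hb hy).add contDiffAt_const)
  · exact contDiffAt_const.congr_of_eventuallyEq (notMem_tsupport_iff_eventuallyEq.1
      fun hy_supp => hy (hH.tsupport_approxGreen_subset hε hb hy_supp))

theorem contDiff_two_approxGreen (hH : IsGreenCorrection D z H) (hε : 0 < ε) (hb : 0 < b) :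
    ContDiff ℝ 2 (approxGreen D H ε z b) :=
  contDiff_infty.1 (hH.contDiff_approxGreen hε hb) 2

/-- `approxGreen` as a test function on `D`. -/
def testFunction (hH : IsGreenCorrection D z H) (hε : 0 < ε) (hb : 0 < b) : 𝓓(D, ℝ) where
  toFun := approxGreen D H ε z b
  contDiff' := hH.contDiff_approxGreen hε hb
  hasCompactSupport' := hH.hasCompactSupport_approxGreen hε hb
  tsupport_subset' := hH.tsupport_approxGreen_subset hε hb

theorem laplacian_smoothGreen (hH : IsGreenCorrection D z H) (hε : 0 < ε) (hb : 0 < b)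
    (hy : y ∈ D) : laplacian (smoothGreen H ε z b) y = -logRampDensity z ε b y := by
  have hsplit : smoothGreen H ε z b =
      (fun y => H y - (Real.log ε - softRamp b (2 * b))) - logRamp z ε b := by
    funext y
    simp only [smoothGreen, Pi.sub_apply]
    ring
  have hharm : InnerProductSpace.HarmonicAt
      (fun y => H y - (Real.log ε - softRamp b (2 * b))) y :=
    (hH.harmonic y hy).sub (InnerProductSpace.harmonicAt_const _)
  rw [hsplit, hharm.1.laplacian_sub (contDiff_two_logRamp hε hb).contDiffAt, hharm.2.eq_of_nhds,
    laplacian_logRamp hε hb, Pi.zero_apply, zero_sub]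

theorem laplacian_approxGreen (hH : IsGreenCorrection D z H) (hε : 0 < ε) (hb : 0 < b)
    (hy : y ∈ D) : laplacian (approxGreen D H ε z b) y =
      -(deriv (softRamp b) (smoothGreen H ε z b y - b) * logRampDensity z ε b y) +
        deriv (deriv (softRamp b)) (smoothGreen H ε z b y - b) *
          ‖gradient (smoothGreen H ε z b) y‖ ^ 2 := by
  rw [(InnerProductSpace.laplacian_congr_nhds (approxGreen_eventuallyEq hy)).eq_of_nhds,
    laplacian_comp_add_const (softRamp.contDiff_two b)
      (contDiffAt_infty.1 (hH.contDiffAt_smoothGreen hε hb hy) 2),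
    hH.laplacian_smoothGreen hε hb hy, ← sub_eq_add_neg, mul_neg]

end IsGreenCorrection

/-! ### The Gram matrix of the approximations -/

/-- The part of `-Δ (approxGreen D H ε z b)` concentrated near the circle `|y - z| = ε`. -/
def innerCharge (H : ℂ → ℝ) (ε : ℝ) (z : ℂ) (b : ℝ) (y : ℂ) : ℝ :=
  deriv (softRamp b) (smoothGreen H ε z b y - b) * logRampDensity z ε b y

/-- The rest of `-Δ (approxGreen D H ε z b)`, with the opposite sign, so that
`-Δ = innerCharge - outerCharge`. It is concentrated where `smoothGreen H ε z b ≤ 2b`. -/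
def outerCharge (D : Opens ℂ) (H : ℂ → ℝ) (ε : ℝ) (z : ℂ) (b : ℝ) (y : ℂ) : ℝ :=
  laplacian (approxGreen D H ε z b) y + innerCharge H ε z b y

section InnerCharge

variable {H : ℂ → ℝ} {ε b : ℝ} {z : ℂ}

theorem innerCharge_nonneg (hb : 0 < b) (y : ℂ) : 0 ≤ innerCharge H ε z b y :=
  mul_nonneg (softRamp.deriv_nonneg _) (logRampDensity_nonneg hb y)

theorem innerCharge_le (hb : 0 < b) (y : ℂ) : innerCharge H ε z b y ≤ logRampDensity z ε b y :=
  mul_le_of_le_one_left (logRampDensity_nonneg hb y) (softRamp.deriv_le_one _)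

theorem hasCompactSupport_innerCharge (hε : 0 < ε) (hb : 0 < b) :
    HasCompactSupport (innerCharge H ε z b) :=
  (hasCompactSupport_logRampDensity hε hb).mul_left

end InnerCharge

namespace IsGreenCorrection

variable {D : Opens ℂ} {z y : ℂ} {H : ℂ → ℝ} {ε a b : ℝ}

theorem continuous_innerCharge (hH : IsGreenCorrection D z H) (hε : 0 < ε)
    (hball : Metric.ball z ε ⊆ D) (hb : 0 < b) : Continuous (innerCharge H ε z b) := by
  refine continuous_mul_of_tsupport_subset D.isOpen (fun y hy => ContinuousAt.continuousWithinAt ?_)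
    (continuous_logRampDensity hε hb) ((tsupport_logRampDensity_subset_ball hε hb).trans hball)
  exact (softRamp.contDiff_deriv b).continuous.continuousAt.comp
    ((hH.contDiffAt_smoothGreen hε hb hy).continuousAt.sub continuousAt_const)

theorem integrable_innerCharge (hH : IsGreenCorrection D z H) (hε : 0 < ε)
    (hball : Metric.ball z ε ⊆ D) (hb : 0 < b) : Integrable (innerCharge H ε z b) :=
  (hH.continuous_innerCharge hε hball hb).integrable_of_hasCompactSupport
    (hasCompactSupport_innerCharge hε hb)

theorem hasCompactSupport_laplacian_approxGreen (hH : IsGreenCorrection D z H) (hε : 0 < ε)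
    (hb : 0 < b) : HasCompactSupport (laplacian (approxGreen D H ε z b)) :=
  (hH.hasCompactSupport_approxGreen hε hb).mono'
    ((subset_tsupport _).trans (tsupport_laplacian_subset _))

theorem continuous_outerCharge (hH : IsGreenCorrection D z H) (hε : 0 < ε)
    (hball : Metric.ball z ε ⊆ D) (hb : 0 < b) : Continuous (outerCharge D H ε z b) :=
  (continuous_laplacian (hH.contDiff_two_approxGreen hε hb)).add
    (hH.continuous_innerCharge hε hball hb)

theorem hasCompactSupport_outerCharge (hH : IsGreenCorrection D z H) (hε : 0 < ε) (hb : 0 < b) :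
    HasCompactSupport (outerCharge D H ε z b) :=
  (hH.hasCompactSupport_laplacian_approxGreen hε hb).add (hasCompactSupport_innerCharge hε hb)

theorem outerCharge_of_mem (hH : IsGreenCorrection D z H) (hε : 0 < ε) (hb : 0 < b) (hy : y ∈ D) :
    outerCharge D H ε z b y = deriv (deriv (softRamp b)) (smoothGreen H ε z b y - b) *
      ‖gradient (smoothGreen H ε z b) y‖ ^ 2 := by
  rw [outerCharge, innerCharge, hH.laplacian_approxGreen hε hb hy]
  ring

theorem outerCharge_of_notMem (hH : IsGreenCorrection D z H) (hε : 0 < ε)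
    (hball : Metric.ball z ε ⊆ D) (hb : 0 < b) (hy : y ∉ D) : outerCharge D H ε z b y = 0 := by
  have hlap : laplacian (approxGreen D H ε z b) y = 0 :=
    image_eq_zero_of_notMem_tsupport fun hy_supp =>
      hy (hH.tsupport_approxGreen_subset hε hb (tsupport_laplacian_subset _ hy_supp))
  have hdensity : logRampDensity z ε b y = 0 :=
    image_eq_zero_of_notMem_tsupport fun hy_supp =>
      hy (hball (tsupport_logRampDensity_subset_ball hε hb hy_supp))
  rw [outerCharge, innerCharge, hlap, hdensity, mul_zero, add_zero]

theorem outerCharge_nonneg (hH : IsGreenCorrection D z H) (hε : 0 < ε)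
    (hball : Metric.ball z ε ⊆ D) (hb : 0 < b) (y : ℂ) : 0 ≤ outerCharge D H ε z b y := by
  by_cases hy : y ∈ D
  · rw [hH.outerCharge_of_mem hε hb hy]
    exact mul_nonneg (softRamp.deriv_deriv_nonneg hb _) (by positivity)
  · exact (hH.outerCharge_of_notMem hε hball hb hy).ge

theorem integral_outerCharge_le (hH : IsGreenCorrection D z H) (hε : 0 < ε)
    (hball : Metric.ball z ε ⊆ D) (hb : 0 < b) : ∫ y, outerCharge D H ε z b y ≤ 2 * Real.pi := by
  have hlap_int : Integrable (laplacian (approxGreen D H ε z b)) :=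
    (continuous_laplacian (hH.contDiff_two_approxGreen hε hb)).integrable_of_hasCompactSupport
      (hH.hasCompactSupport_laplacian_approxGreen hε hb)
  have hinner_int := hH.integrable_innerCharge hε hball hb
  calc ∫ y, outerCharge D H ε z b y
      = (∫ y, laplacian (approxGreen D H ε z b) y) + ∫ y, innerCharge H ε z b y :=
        integral_add hlap_int hinner_int
    _ = ∫ y, innerCharge H ε z b y := by
        rw [integral_laplacian_eq_zero (hH.contDiff_two_approxGreen hε hb)
          (hH.hasCompactSupport_approxGreen hε hb), zero_add]
    _ ≤ ∫ y, logRampDensity z ε b y :=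
        integral_mono hinner_int (integrable_logRampDensity hε hb) (innerCharge_le hb)
    _ = 2 * Real.pi := integral_logRampDensity hε hb

theorem approxGreen_le_of_smoothGreen_le (hH : IsGreenCorrection D z H) (hε : 0 < ε)
    (hball : Metric.ball z ε ⊆ D) (ha : 0 < a) (hb : 0 < b) (hy : y ∈ D)
    (hle : smoothGreen H ε z b y ≤ 2 * b) : approxGreen D H ε z a y ≤ 2 * (a + b) := by
  linarith [(abs_le.1 (hH.abs_approxGreen_sub_le hε hball ha hy)).2,
    truncGreen_le_smoothGreen (H := H) (z := z) hε hb y]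

theorem approxGreen_mul_outerCharge_le (hH : IsGreenCorrection D z H) (hε : 0 < ε)
    (hball : Metric.ball z ε ⊆ D) (ha : 0 < a) (hb : 0 < b) (y : ℂ) :
    approxGreen D H ε z a y * outerCharge D H ε z b y ≤ 2 * (a + b) * outerCharge D H ε z b y := by
  by_cases hy : y ∈ D
  · rcases le_or_gt (smoothGreen H ε z b y) (2 * b) with hle | hlt
    · exact mul_le_mul_of_nonneg_right (hH.approxGreen_le_of_smoothGreen_le hε hball ha hb hy hle)
        (hH.outerCharge_nonneg hε hball hb y)
    · rw [hH.outerCharge_of_mem hε hb hy, softRamp.deriv_deriv_eq_zero_of_lt hb (by linarith)]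
      simp
  · rw [hH.outerCharge_of_notMem hε hball hb hy, mul_zero, mul_zero]

theorem integrable_approxGreen_mul_outerCharge (hH : IsGreenCorrection D z H) (hε : 0 < ε)
    (hball : Metric.ball z ε ⊆ D) (ha : 0 < a) (hb : 0 < b) :
    Integrable fun y => approxGreen D H ε z a y * outerCharge D H ε z b y :=
  ((hH.contDiff_approxGreen hε ha).continuous.mul
    (hH.continuous_outerCharge hε hball hb)).integrable_of_hasCompactSupport
      (hH.hasCompactSupport_outerCharge hε hb).mul_left

theorem integrable_approxGreen_mul_innerCharge (hH : IsGreenCorrection D z H) (hε : 0 < ε)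
    (hball : Metric.ball z ε ⊆ D) (ha : 0 < a) (hb : 0 < b) :
    Integrable fun y => approxGreen D H ε z a y * innerCharge H ε z b y :=
  ((hH.contDiff_approxGreen hε ha).continuous.mul
    (hH.continuous_innerCharge hε hball hb)).integrable_of_hasCompactSupport
      (hasCompactSupport_innerCharge hε hb).mul_left

theorem integral_approxGreen_mul_outerCharge_mem_Icc (hH : IsGreenCorrection D z H) (hε : 0 < ε)
    (hball : Metric.ball z ε ⊆ D) (ha : 0 < a) (hb : 0 < b) :
    ∫ y, approxGreen D H ε z a y * outerCharge D H ε z b y ∈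
      Set.Icc 0 (2 * (a + b) * (2 * Real.pi)) := by
  have houter_int : Integrable (outerCharge D H ε z b) :=
    (hH.continuous_outerCharge hε hball hb).integrable_of_hasCompactSupport
      (hH.hasCompactSupport_outerCharge hε hb)
  refine ⟨integral_nonneg fun y =>
    mul_nonneg (approxGreen_nonneg ha y) (hH.outerCharge_nonneg hε hball hb y), ?_⟩
  calc ∫ y, approxGreen D H ε z a y * outerCharge D H ε z b y
      ≤ ∫ y, 2 * (a + b) * outerCharge D H ε z b y :=
        integral_mono (hH.integrable_approxGreen_mul_outerCharge hε hball ha hb)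
          (houter_int.const_mul _) (hH.approxGreen_mul_outerCharge_le hε hball ha hb)
    _ = 2 * (a + b) * ∫ y, outerCharge D H ε z b y := integral_const_mul _ _
    _ ≤ 2 * (a + b) * (2 * Real.pi) :=
        mul_le_mul_of_nonneg_left (hH.integral_outerCharge_le hε hball hb) (by linarith)

theorem abs_approxGreen_mul_innerCharge_sub_le (hH : IsGreenCorrection D z H) (hε : 0 < ε)
    (hball : Metric.ball z ε ⊆ D) (ha : 0 < a) (hb : 0 < b) (y : ℂ) :
    |approxGreen D H ε z a y * innerCharge H ε z b y -
      (H y - Real.log ε) * logRampDensity z ε b y| ≤ 2 * (a + b) * logRampDensity z ε b y := by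
  rcases eq_or_ne (logRampDensity z ε b y) 0 with hzero | hne
  · simp [innerCharge, hzero]
  have hdensity := logRampDensity_nonneg (z := z) (ε := ε) hb y
  have hnorm : ‖y - z‖ < ε := norm_sub_lt_of_logRampDensity_ne_zero hε hb hne
  have hyD : y ∈ D := hball (mem_ball_iff_norm.2 hnorm)
  have happrox := abs_le.1 (hH.abs_approxGreen_sub_le hε hball ha hyD)
  have hnonneg := hH.truncGreen_nonneg hε hball hyD
  have hsmooth := truncGreen_le_smoothGreen (H := H) (z := z) hε hb y
  rw [truncGreen_of_norm_le hnorm.le] at happrox hnonneg hsmooth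
  rcases le_or_gt (smoothGreen H ε z b y) (2 * b) with hle | hlt
  -- below the level `2b` both terms lie between `0` and the right-hand side
  · have hproduct : approxGreen D H ε z a y * innerCharge H ε z b y ≤
        2 * (a + b) * logRampDensity z ε b y :=
      mul_le_mul (hH.approxGreen_le_of_smoothGreen_le hε hball ha hb hyD hle)
        (innerCharge_le hb y) (innerCharge_nonneg hb y) (by linarith)
    have htrunc : (H y - Real.log ε) * logRampDensity z ε b y ≤
        2 * (a + b) * logRampDensity z ε b y :=
      mul_le_mul_of_nonneg_right (by linarith) hdensity
    exact abs_sub_le_of_nonneg_of_le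
      (mul_nonneg (approxGreen_nonneg ha y) (innerCharge_nonneg hb y)) hproduct
      (mul_nonneg hnonneg hdensity) htrunc
  -- above it the cut-off is inactive
  · rw [innerCharge, softRamp.deriv_eq_one hb (by linarith), one_mul, ← sub_mul, abs_mul,
      abs_of_nonneg hdensity]
    refine mul_le_mul_of_nonneg_right (abs_le.2 ⟨?_, ?_⟩) hdensity <;> linarith

theorem abs_integral_approxGreen_mul_innerCharge_sub_le (hH : IsGreenCorrection D z H)
    (hε : 0 < ε) (hball : Metric.ball z ε ⊆ D) (ha : 0 < a) (hb : 0 < b) :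
    |(∫ y, approxGreen D H ε z a y * innerCharge H ε z b y) -
      2 * Real.pi * (H z - Real.log ε)| ≤ 2 * (a + b) * (2 * Real.pi) := by
  have hharm : InnerProductSpace.HarmonicOnNhd (fun y => H y - Real.log ε) (Metric.ball z ε) :=
    (hH.harmonic.mono hball).sub (InnerProductSpace.harmonicOnNhd_const (Real.log ε))
  rw [← integral_mul_logRampDensity hε hb hharm, ← integral_logRampDensity (z := z) hε hb,
    ← integral_sub (hH.integrable_approxGreen_mul_innerCharge hε hball ha hb)
      (integrable_mul_logRampDensity hε hb hharm.continuousOn), ← integral_const_mul]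
  exact norm_integral_le_of_norm_le (f := fun y =>
    approxGreen D H ε z a y * innerCharge H ε z b y -
      (H y - Real.log ε) * logRampDensity z ε b y) ((integrable_logRampDensity hε hb).const_mul _)
    (Eventually.of_forall (hH.abs_approxGreen_mul_innerCharge_sub_le hε hball ha hb))

theorem abs_neg_integral_approxGreen_mul_laplacian_sub_le (hH : IsGreenCorrection D z H)
    (hε : 0 < ε) (hball : Metric.ball z ε ⊆ D) (ha : 0 < a) (hb : 0 < b) :
    |(-∫ y, approxGreen D H ε z a y * laplacian (approxGreen D H ε z b) y) -
      2 * Real.pi * (H z - Real.log ε)| ≤ 2 * Real.pi * (4 * (a + b)) := by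
  have hsplit : -∫ y, approxGreen D H ε z a y * laplacian (approxGreen D H ε z b) y =
      (∫ y, approxGreen D H ε z a y * innerCharge H ε z b y) -
        ∫ y, approxGreen D H ε z a y * outerCharge D H ε z b y := by
    rw [← integral_sub (hH.integrable_approxGreen_mul_innerCharge hε hball ha hb)
      (hH.integrable_approxGreen_mul_outerCharge hε hball ha hb), ← integral_neg]
    congr 1
    funext y
    rw [outerCharge]
    ring
  have hinner := abs_le.1 (hH.abs_integral_approxGreen_mul_innerCharge_sub_le hε hball ha hb)
  have houter := hH.integral_approxGreen_mul_outerCharge_mem_Icc hε hball ha hb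
  rw [hsplit, abs_le]
  constructor <;> linarith [hinner.1, hinner.2, houter.1, houter.2]

end IsGreenCorrection

/-! ### The Dirichlet inner product -/

section DirichletProduct

variable {D : Opens ℂ} {f : ℂ → ℝ} {u u' : H1 D}

theorem inner_gradL2 (f g : 𝓓(D, ℝ)) :
    inner ℝ (gradL2 D f) (gradL2 D g) =
      (2 * Real.pi)⁻¹ * -∫ y, f y * laplacian (g : ℂ → ℝ) y := by
  have hgrad : ∀ y ∉ (D : Set ℂ),
      inner ℝ (gradient (f : ℂ → ℝ) y) (gradient (g : ℂ → ℝ) y) = 0 := by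
    intro y hy
    have hfderiv : fderiv ℝ (f : ℂ → ℝ) y = 0 := image_eq_zero_of_notMem_tsupport fun hmem =>
      hy (f.tsupport_subset (tsupport_fderiv_subset ℝ hmem))
    rw [gradient, hfderiv, map_zero, inner_zero_left]
  rw [← integral_inner_gradient (contDiff_infty.1 f.contDiff 1) (contDiff_infty.1 g.contDiff 2)
    g.hasCompactSupport, L2.inner_def, ← setIntegral_eq_integral_of_forall_compl_eq_zero hgrad]
  calc ∫ y, inner ℝ (gradL2 D f y) (gradL2 D g y) ∂dirichletMeasure D
      = ∫ y, inner ℝ (gradient (f : ℂ → ℝ) y) (gradient (g : ℂ → ℝ) y) ∂dirichletMeasure D := by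
        refine integral_congr_ae ?_
        filter_upwards [(memLp_gradient D f).coeFn_toLp, (memLp_gradient D g).coeFn_toLp]
          with y hf hg
        exact congrArg₂ (inner ℝ) hf hg
    _ = _ := by
        rw [dirichletMeasure, integral_smul_measure, ENNReal.toReal_ofReal (by positivity),
          smul_eq_mul]

theorem tendsto_integral_mul_of_tendsto_lintegral_enorm {α ι : Type*} [MeasurableSpace α]
    {μ : Measure α} {l : Filter ι} {u : ι → α → ℝ} {v : α → ℝ} {M : ℝ} (hv : ∀ x, ‖v x‖ ≤ M)
    (hu : Tendsto (fun n => ∫⁻ x, ‖u n x‖ₑ ∂μ) l (𝓝 0)) :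
    Tendsto (fun n => ∫ x, u n x * v x ∂μ) l (𝓝 0) := by
  have hle : ∀ n, ‖∫ x, u n x * v x ∂μ‖ₑ ≤ (∫⁻ x, ‖u n x‖ₑ ∂μ) * ENNReal.ofReal M := by
    intro n
    rw [← lintegral_mul_const' _ _ ENNReal.ofReal_ne_top]
    refine (enorm_integral_le_lintegral_enorm _).trans (lintegral_mono fun x => ?_)
    rw [enorm_mul, ← ofReal_norm (v x)]
    gcongr
    exact hv x
  have hlim : Tendsto (fun n => (∫⁻ x, ‖u n x‖ₑ ∂μ) * ENNReal.ofReal M) l (𝓝 0) := by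
    simpa only [zero_mul] using ENNReal.Tendsto.mul_const hu (Or.inr ENNReal.ofReal_ne_top)
  exact tendsto_zero_iff_enorm_tendsto_zero.2
    (tendsto_of_tendsto_of_tendsto_of_le_of_le tendsto_const_nhds hlim (fun _ => zero_le) hle)

theorem inner_gradL2_eq_zero_of_tendsto {d : ℕ → 𝓓(D, ℝ)} {w : Lp ℂ 2 (dirichletMeasure D)}
    (hw : Tendsto (fun n => gradL2 D (d n)) atTop (𝓝 w))
    (hd : ∀ K : Set ℂ, IsCompact K → K ⊆ D →
      Tendsto (fun n => ∫⁻ x in K, ‖d n x‖ₑ) atTop (𝓝 0)) (g : 𝓓(D, ℝ)) :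
    inner ℝ w (gradL2 D g) = 0 := by
  have hsupp := tsupport_laplacian_subset (g : ℂ → ℝ)
  have hcont := continuous_laplacian (contDiff_infty.1 g.contDiff 2)
  obtain ⟨M, hM⟩ := hcont.bounded_above_of_compact_support
    (g.hasCompactSupport.mono' ((subset_tsupport _).trans hsupp))
  have hpair : Tendsto (fun n => ∫ y, d n y * laplacian (g : ℂ → ℝ) y) atTop (𝓝 0) := by
    refine (tendsto_integral_mul_of_tendsto_lintegral_enorm hM
      (hd _ g.hasCompactSupport g.tsupport_subset)).congr fun n => ?_
    refine setIntegral_eq_integral_of_forall_compl_eq_zero fun y hy => ?_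
    rw [image_eq_zero_of_notMem_tsupport fun hmem => hy (hsupp hmem), mul_zero]
  refine tendsto_nhds_unique (hw.inner tendsto_const_nhds) ?_
  simpa only [inner_gradL2, neg_zero, mul_zero] using hpair.neg.const_mul (2 * Real.pi)⁻¹

theorem tendsto_lintegral_enorm_sub {α ι E : Type*} [MeasurableSpace α] [NormedAddCommGroup E]
    {μ : Measure α} {l : Filter ι} {u v : ι → α → E} {f : α → E}
    (hmeas : ∀ n, AEStronglyMeasurable (fun x => u n x - f x) μ)
    (hu : Tendsto (fun n => ∫⁻ x, ‖u n x - f x‖ₑ ∂μ) l (𝓝 0))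
    (hv : Tendsto (fun n => ∫⁻ x, ‖v n x - f x‖ₑ ∂μ) l (𝓝 0)) :
    Tendsto (fun n => ∫⁻ x, ‖u n x - v n x‖ₑ ∂μ) l (𝓝 0) := by
  have hle : ∀ n, ∫⁻ x, ‖u n x - v n x‖ₑ ∂μ ≤
      (∫⁻ x, ‖u n x - f x‖ₑ ∂μ) + ∫⁻ x, ‖v n x - f x‖ₑ ∂μ := by
    intro n
    rw [← lintegral_add_left' (hmeas n).enorm]
    refine lintegral_mono fun x => ?_
    rw [← sub_sub_sub_cancel_right _ _ (f x)]
    exact enorm_sub_le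
  refine tendsto_of_tendsto_of_tendsto_of_le_of_le tendsto_const_nhds ?_ (fun _ => zero_le) hle
  simpa only [add_zero] using hu.add hv

theorem H1.eq_zero_of_inner_gradL2_eq_zero (h : ∀ g, inner ℝ (u : Lp ℂ 2 (dirichletMeasure D))
    (gradL2 D g) = 0) : u = 0 := by
  have hmem : (u : Lp ℂ 2 (dirichletMeasure D)) ∈ (LinearMap.range (gradL2 D))ᗮ :=
    (Submodule.mem_orthogonal' _ _).2 (by rintro _ ⟨g, rfl⟩; exact h g)
  rw [← Submodule.orthogonal_closure] at hmem
  exact Subtype.ext (inner_self_eq_zero.1 (Submodule.inner_right_of_mem_orthogonal u.2 hmem))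

theorem Represents.unique (hf : ContinuousOn f D) (hu : Represents u f) (hu' : Represents u' f) :
    u = u' := by
  obtain ⟨φ, hφ, hφf⟩ := hu
  obtain ⟨φ', hφ', hφf'⟩ := hu'
  have hdiff : Tendsto (fun n => gradL2 D (φ n - φ' n)) atTop
      (𝓝 ((u - u' : H1 D) : Lp ℂ 2 (dirichletMeasure D))) := by
    simpa only [map_sub, Submodule.coe_sub] using hφ.sub hφ'
  refine sub_eq_zero.1 (H1.eq_zero_of_inner_gradL2_eq_zero
    (inner_gradL2_eq_zero_of_tendsto hdiff fun K hK hKD => ?_))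
  refine tendsto_lintegral_enorm_sub (fun n => ?_) (hφf K hK hKD) (hφf' K hK hKD)
  exact ((φ n).continuous.continuousOn.sub (hf.mono hKD)).aestronglyMeasurable hK.measurableSet

theorem Represents.congr {g : ℂ → ℝ} (hu : Represents u f) (hfg : Set.EqOn f g D) :
    Represents u g := by
  obtain ⟨φ, hφ, hφf⟩ := hu
  refine ⟨φ, hφ, fun K hK hKD => (hφf K hK hKD).congr fun n => ?_⟩
  exact setLIntegral_congr_fun hK.measurableSet fun y hy => by rw [hfg (hKD hy)]

theorem Represents.toH1_eq (hf : ContinuousOn f D) (hu : Represents u f) : toH1 D f = u := by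
  have hmem : MemH1 D f := ⟨u, hu⟩
  rw [toH1, dif_pos hmem]
  exact hmem.choose_spec.unique hf hu

end DirichletProduct

/-! ### The truncated Green's function as an element of `H¹₀(D)` -/

theorem exists_tendsto_of_inner_tendsto {E : Type*} [NormedAddCommGroup E] [InnerProductSpace ℝ E]
    [CompleteSpace E] {x : ℕ → E} {a : ℕ → ℝ} {T : ℝ} (ha : Antitone a)
    (ha0 : Tendsto a atTop (𝓝 0)) (hx : ∀ n m, |inner ℝ (x n) (x m) - T| ≤ a n + a m) :
    ∃ y, Tendsto x atTop (𝓝 y) ∧ ‖y‖ ^ 2 = T := by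
  have hsq : ∀ n m, ‖x n - x m‖ ^ 2 ≤ 4 * (a n + a m) := by
    intro n m
    rw [norm_sub_sq_real, ← real_inner_self_eq_norm_sq, ← real_inner_self_eq_norm_sq]
    linarith [(abs_le.1 (hx n n)).2, (abs_le.1 (hx n m)).1, (abs_le.1 (hx m m)).2]
  have hcauchy : CauchySeq x := by
    refine cauchySeq_of_le_tendsto_0 (fun N => Real.sqrt (8 * a N)) (fun n m N hn hm => ?_) ?_
    · rw [dist_eq_norm]
      exact Real.le_sqrt_of_sq_le ((hsq n m).trans (by linarith [ha hn, ha hm]))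
    · simpa only [mul_zero, Real.sqrt_zero] using (ha0.const_mul 8).sqrt
  obtain ⟨y, hy⟩ := cauchySeq_tendsto_of_complete hcauchy
  have hself : Tendsto (fun n => inner ℝ (x n) (x n) - T) atTop (𝓝 0) :=
    squeeze_zero_norm (fun n => hx n n) (by simpa only [add_zero] using ha0.add ha0)
  refine ⟨y, hy, tendsto_nhds_unique (hy.norm.pow 2) ?_⟩
  simpa only [real_inner_self_eq_norm_sq, sub_add_cancel, zero_add] using hself.add_const T

theorem tendsto_lintegral_enorm_of_norm_le {α ι E : Type*} [MeasurableSpace α]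
    [SeminormedAddCommGroup E] {μ : Measure α} [IsFiniteMeasure μ] {l : Filter ι}
    {u : ι → α → E} {δ : ι → ℝ} (hδ : Tendsto δ l (𝓝 0)) (hu : ∀ n, ∀ᵐ x ∂μ, ‖u n x‖ ≤ δ n) :
    Tendsto (fun n => ∫⁻ x, ‖u n x‖ₑ ∂μ) l (𝓝 0) := by
  have hle : ∀ n, ∫⁻ x, ‖u n x‖ₑ ∂μ ≤ ENNReal.ofReal (δ n) * μ Set.univ := by
    intro n
    rw [← lintegral_const]
    refine lintegral_mono_ae ((hu n).mono fun x hx => ?_)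
    rw [← ofReal_norm]
    exact ENNReal.ofReal_le_ofReal hx
  have hlim : Tendsto (fun n => ENNReal.ofReal (δ n) * μ Set.univ) l (𝓝 0) := by
    simpa only [ENNReal.ofReal_zero, zero_mul] using ENNReal.Tendsto.mul_const
      (ENNReal.tendsto_ofReal hδ) (Or.inr (measure_ne_top μ Set.univ))
  exact tendsto_of_tendsto_of_tendsto_of_le_of_le tendsto_const_nhds hlim (fun _ => zero_le) hle

namespace IsGreenCorrection

variable {D : Opens ℂ} {z : ℂ} {H : ℂ → ℝ} {ε a b : ℝ}

theorem abs_inner_gradL2_sub_le (hH : IsGreenCorrection D z H) (hε : 0 < ε)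
    (hball : Metric.ball z ε ⊆ D) (ha : 0 < a) (hb : 0 < b) :
    |inner ℝ (gradL2 D (hH.testFunction hε ha)) (gradL2 D (hH.testFunction hε hb)) -
      (H z - Real.log ε)| ≤ 4 * a + 4 * b := by
  have hgram := hH.abs_neg_integral_approxGreen_mul_laplacian_sub_le hε hball ha hb
  rw [inner_gradL2]
  change |(2 * Real.pi)⁻¹ *
    (-∫ y, approxGreen D H ε z a y * laplacian (approxGreen D H ε z b) y) - _| ≤ _
  set I := -∫ y, approxGreen D H ε z a y * laplacian (approxGreen D H ε z b) y
  have hscale : (2 * Real.pi)⁻¹ * I - (H z - Real.log ε) =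
      (2 * Real.pi)⁻¹ * (I - 2 * Real.pi * (H z - Real.log ε)) := by
    field_simp
  rwa [hscale, abs_mul, abs_of_pos (by positivity), inv_mul_le_iff₀ (by positivity), ← mul_add]

theorem exists_represents_truncGreen (hH : IsGreenCorrection D z H) (hε : 0 < ε)
    (hball : Metric.ball z ε ⊆ D) :
    ∃ u : H1 D, Represents u (truncGreen H ε z) ∧ ‖u‖ ^ 2 = H z - Real.log ε := by
  set a : ℕ → ℝ := fun n => 1 / ((n : ℝ) + 1)
  have ha : ∀ n, 0 < a n := fun n => Nat.one_div_pos_of_nat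
  have ha0 : ∀ c : ℝ, Tendsto (fun n => c * a n) atTop (𝓝 0) := fun c => by
    simpa only [mul_zero] using tendsto_one_div_add_atTop_nhds_zero_nat.const_mul c
  have hanti : Antitone fun n => 4 * a n := fun n m hnm =>
    mul_le_mul_of_nonneg_left (Nat.one_div_le_one_div hnm) zero_le_four
  obtain ⟨w, hw, hnorm⟩ := exists_tendsto_of_inner_tendsto hanti (ha0 4)
    fun n m => hH.abs_inner_gradL2_sub_le hε hball (ha n) (ha m)
  have hwH : w ∈ H1 D := mem_closure_of_tendsto hw (Eventually.of_forall fun n => ⟨_, rfl⟩)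
  refine ⟨⟨w, hwH⟩, ⟨fun n => hH.testFunction hε (ha n), hw, fun K hK hKD => ?_⟩, hnorm⟩
  have : IsFiniteMeasure (volume.restrict K) := ⟨by simpa using hK.measure_lt_top⟩
  refine tendsto_lintegral_enorm_of_norm_le (ha0 2) fun n => ?_
  exact (ae_restrict_mem hK.measurableSet).mono fun y hy =>
    hH.abs_approxGreen_sub_le hε hball (ha n) (hKD hy)

theorem regGreen_eqOn (hH : IsGreenCorrection D z H) :
    Set.EqOn (regGreen D ε z) (truncGreen H ε z) D := fun _ hy =>
  congrArg (_ + ·) (hH.greenCorrection_eqOn hy)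

theorem continuousOn_regGreen (hH : IsGreenCorrection D z H) (hε : 0 < ε) :
    ContinuousOn (regGreen D ε z) D := by
  refine ContinuousOn.congr ?_ hH.regGreen_eqOn
  refine ContinuousOn.add (Continuous.continuousOn ?_) hH.harmonic.continuousOn
  have hpos : ∀ y : ℂ, max ε ‖z - y‖ ≠ 0 := fun y => (lt_max_of_lt_left hε).ne'
  exact (continuous_const.div (by fun_prop) hpos).log fun y => one_div_ne_zero (hpos y)

theorem exists_represents_regGreen (hH : IsGreenCorrection D z H) (hε : 0 < ε)
    (hball : Metric.ball z ε ⊆ D) :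
    ∃ u : H1 D, Represents u (regGreen D ε z) ∧ ‖u‖ ^ 2 = H z - Real.log ε := by
  obtain ⟨u, hu, hnorm⟩ := hH.exists_represents_truncGreen hε hball
  exact ⟨u, hu.congr hH.regGreen_eqOn.symm, hnorm⟩

end IsGreenCorrection

theorem ball_subset_of_le_infDist_frontier {E : Type*} [SeminormedAddCommGroup E]
    [NormedSpace ℝ E] {s : Set E} {x : E} {r : ℝ} (hx : x ∈ s)
    (hr : r ≤ Metric.infDist x (frontier s)) : Metric.ball x r ⊆ s := by
  rcases le_or_gt r 0 with hr0 | hr0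
  · simp only [Metric.ball_eq_empty.2 hr0, Set.empty_subset]
  have hinterior : ∀ y ∈ Metric.ball x r, y ∈ closure s → y ∈ interior s := by
    refine fun y hy hys => by_contra fun hyi => ?_
    have hdist := hr.trans (Metric.infDist_le_dist_of_mem ⟨hys, hyi⟩)
    exact (Metric.mem_ball'.1 hy).not_ge hdist
  have hxr := Metric.mem_ball_self (x := x) hr0
  refine ((convex_ball x r).isPreconnected.subset_left_of_subset_union isOpen_interior
    isClosed_closure.isOpen_compl (disjoint_compl_right.mono_left interior_subset_closure)
    (fun y hy => ?_) ⟨x, hxr, hinterior x hxr (subset_closure hx)⟩).trans interior_subset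
  exact (em (y ∈ closure s)).imp_left (hinterior y hy)

end PlanarGFF

end

theorem lemmal_general {Ω : Type*} [MeasurableSpace Ω] {P : Measure Ω} {D : Opens ℂ}
    (h : PlanarGFF.GFF D P) {z : ℂ} {H : ℂ → ℝ} (hH : PlanarGFF.IsGreenCorrection D z H)
    {ε : ℝ} (hε : 0 < ε) (hball : Metric.ball z ε ⊆ D) :
    PlanarGFF.MemH1 D (PlanarGFF.regGreen D ε z) ∧
    (∀ᵐ ω ∂P, Tendsto
      (fun N => h.partialPairing (PlanarGFF.toH1 D (PlanarGFF.regGreen D ε z)) N ω)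
      atTop (𝓝 (h.circleAvg ε z ω))) ∧
    MemLp (h.circleAvg ε z) 2 P ∧
    variance (h.circleAvg ε z) P = Real.log (1 / ε) + H z := by
  obtain ⟨u, hu, hnorm⟩ := hH.exists_represents_regGreen hε hball
  refine ⟨⟨u, hu⟩, h.ae_tendsto_pairing _, h.memLp_pairing _, ?_⟩
  rw [PlanarGFF.GFF.circleAvg, h.variance_pairing, hu.toH1_eq (hH.continuousOn_regGreen hε), hnorm,
    one_div, Real.log_inv, sub_eq_neg_add]

theorem lemmal {Ω : Type*} [MeasurableSpace Ω] (P : Measure Ω) [IsProbabilityMeasure P]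
    (D : Opens ℂ) (h : PlanarGFF.GFF D P) (z : ℂ) (hz : z ∈ D)
    (C : ℝ) (hC : PlanarGFF.IsConformalRadius D z C)
    (ε : ℝ) (hε : 0 < ε) (hεD : ε ≤ Metric.infDist z (frontier (D : Set ℂ))) :
    PlanarGFF.MemH1 D (PlanarGFF.regGreen D ε z) ∧
    (∀ᵐ ω ∂P, Tendsto
      (fun N => h.partialPairing (PlanarGFF.toH1 D (PlanarGFF.regGreen D ε z)) N ω)
      atTop (𝓝 (h.circleAvg ε z ω))) ∧
    MemLp (h.circleAvg ε z) 2 P ∧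
    variance (h.circleAvg ε z) P = Real.log (1 / ε) + Real.log C := by
  obtain ⟨φ, hφ, hφz, rfl⟩ := hC
  rw [Real.log_inv, ← dslope_same φ z]
  exact lemmal_general h (hφ.isGreenCorrection hz hφz) hε
    (PlanarGFF.ball_subset_of_le_infDist_frontier hz hεD)
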